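/- **Setting.** Let $\mathbb{A}$ be a small category and let $M:\mathbb{A}^{\mathrm{op}}\times\mathbb{A}\to\mathbf{Set}$ be a functor. Write $m:b\nrightarrow a$ for $m\in M(b,a)$, and $fm$, $mg$ for the actions of arrows $f:a\to a'$ and $g:b'\to b$. For $X:\mathbb{A}\to\mathbf{Set}$ and $Y:\mathbb{A}^{\mathrm{op}}\to\mathbf{Set}$ let $Y\otimes X=\bigl(\sum_b Y(b)\times X(b)\bigr)/\!\sim$, where $\sim$ is generated by $(yg,x)\sim(y,gx)$, and write $y\otimes x$ for the class of $(y,x)$. If $X$ takes values in $\mathbf{Top}$, then $Y\otimes X$ carries the quotient topology (each $Y(b)$ being discrete). Let $M\otimes X$ be the functor $a\mapsto M(-,a)\otimes X$. A functor $X:\mathbb{A}\to\mathbf{Set}$ is *nondegenerate* if $-\otimes X:[\mathbb{A}^{\mathrm{op}},\mathbf{Set}]\to\mathbf{Set}$ preserves finite connected limits. A functor $X:\mathbb{A}\to\mathbf{Top}$ is *nondegenerate* if its underlying $\mathbf{Set}$-valued functor is nondegenerate and $Xf$ is a closed map for every arrow $f$. Assume that $(\mathbb{A},M)$ is an *equational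 system*: for each $a$ the category of elements of $M(-,a)$ is finite, and for each $b$ the functor $M(b,-)$ is nondegenerate. An *$M$-coalgebra in $\mathbf{Top}$* is a nondegenerate functor $X:\mathbb{A}\to\mathbf{Top}$ together with a natural transformation $\xi:X\to M\otimes X$; a map $(X,\xi)\to(X',\xi')$ of $M$-coalgebras is a natural transformation $h:X\to X'$ with $(M\otimes h)\circ\xi=\xi'\circ h$. A *complex* is a diagram $\cdots\overset{m_2}{\nrightarrow}a_1\overset{m_1}{\nrightarrow}a_0$; a *map of complexes* $(a_\bullet,m_\bullet)\to(a'_\bullet,m'_\bullet)$ is a sequence of arrows $f_n:a_n\to a'_n$ $(n\ge 0)$ with $f_{n-1}m_n=m'_nf_n$ for all $n\ge1$. For $a\in\mathbb{A}$ let $\mathcal{I}(a)$ be the category of complexes with $a_0=a$ and maps with $f_0=1_a$, and let $I(a)$ be its set of connected components. Write $[a_\bullet,m_\bullet]$ for the component of a complex. An arrow $f:a\to a'$ induces $If:I(a)\to I(a')$, replacing $m_1$ by $fm_1$. Let $$\iota_a:I(a)\to(M\otimes I)(a),\qquad [\cdots\overset{m_2}{\nrightarrow}a_1\overset{m_1}{\nrightarrow}a]\mapsto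 m_1\otimes[\cdots\overset{m_2}{\nrightarrow}a_1].$$ For a finite diagram $a_n\overset{m_n}{\nrightarrow}\cdots\overset{m_1}{\nrightarrow}a_0=a$ $(n\ge0)$, let $V_{m_1,\dots,m_n}\subseteq I(a)$ be the set of all components of complexes ending in this diagram. Give $I(a)$ the coarsest topology in which all the sets $V_{m_1,\dots,m_n}$ are closed. Condition **S** is the conjunction of: * **S1.** Whenever $f_\bullet:(a_\bullet,m_\bullet)\to(b_\bullet,p_\bullet)$ and $f'_\bullet:(a'_\bullet,m'_\bullet)\to(b_\bullet,p_\bullet)$ are maps of complexes, there are $c\in\mathbb{A}$ and arrows $g:c\to a_0$, $g':c\to a'_0$ with $f_0g=f'_0g'$. * **S2.** Whenever $f_\bullet,f'_\bullet:(a_\bullet,m_\bullet)\to(b_\bullet,p_\bullet)$ are maps of complexes, there are $c\in\mathbb{A}$ and an arrow $g:c\to a_0$ with $f_0g=f'_0g$. **Theorem (Universal solution in $\mathbf{Top}$).** Let $(\mathbb{A},M)$ be an equational system satisfying **S**. Then each space $I(a)$ is compact and Hausdorff; all maps $If$ and $\iota_a$ are continuous and, with these, $(I,\iota)$ is an $M$-coalgebra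 in $\mathbf{Top}$ (in particular $I$ is nondegenerate); and $(I,\iota)$ is a terminal object in the category of $M$-coalgebras in $\mathbf{Top}$. -/

import Mathlib

open CategoryTheory CategoryTheory.Limits Opposite

universe u

namespace SelfSim

section

variable {A : Type u} [SmallCategory A]

/-! ### The tensor product of a presheaf with a functor -/

/-- The disjoint union of the sets `Y b × X b`, written as the sum over all pairs `(b, y)`
with `y ∈ Y b` of copies of `X b`. -/
abbrev PreTensor (Y : Aᵒᵖ ⥤ Type u) (X : A ⥤ Type u) : Type u :=
  Σ p : (Σ b : A, Y.obj (op b)), X.obj p.1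

/-- The relation `(y g, x) ∼ (y, g x)` for `g : b' ⟶ b`, `y ∈ Y b`, `x ∈ X b'`. -/
inductive TensorRel (Y : Aᵒᵖ ⥤ Type u) (X : A ⥤ Type u) : PreTensor Y X → PreTensor Y X → Prop
  | glue {b b' : A} (g : b' ⟶ b) (y : Y.obj (op b)) (x : X.obj b') :
      TensorRel Y X ⟨⟨b', Y.map g.op y⟩, x⟩ ⟨⟨b, y⟩, X.map g x⟩

/-- `Y ⊗ X`, the coend of `Y b × X b` over `b`: the quotient of the disjoint union of the
`Y b × X b` by the equivalence relation generated by `TensorRel`. -/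
def Tensor (Y : Aᵒᵖ ⥤ Type u) (X : A ⥤ Type u) : Type u := Quot (TensorRel Y X)

/-- The element `y ⊗ x`. -/
def Tensor.tmul {Y : Aᵒᵖ ⥤ Type u} {X : A ⥤ Type u} {b : A} (y : Y.obj (op b)) (x : X.obj b) :
    Tensor Y X :=
  Quot.mk _ ⟨⟨b, y⟩, x⟩

theorem Tensor.tmul_glue {Y : Aᵒᵖ ⥤ Type u} {X : A ⥤ Type u} {b b' : A} (g : b' ⟶ b)
    (y : Y.obj (op b)) (x : X.obj b') :
    Tensor.tmul (Y.map g.op y) x = (Tensor.tmul y (X.map g x) : Tensor Y X) :=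
  Quot.sound (TensorRel.glue g y x)

/-- Functoriality of `Y ⊗ X` in both variables: `y ⊗ x ↦ α y ⊗ β x`. -/
def Tensor.map {Y Y' : Aᵒᵖ ⥤ Type u} {X X' : A ⥤ Type u} (α : Y ⟶ Y') (β : X ⟶ X') :
    Tensor Y X → Tensor Y' X' :=
  Quot.lift (fun p => Tensor.tmul (α.app (op p.1.1) p.1.2) (β.app p.1.1 p.2)) (by
    rintro _ _ ⟨g, y, x⟩
    dsimp only
    rw [NatTrans.naturality_apply α g.op y, NatTrans.naturality_apply β g x]
    exact Tensor.tmul_glue g _ _)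

theorem Tensor.map_tmul {Y Y' : Aᵒᵖ ⥤ Type u} {X X' : A ⥤ Type u} (α : Y ⟶ Y') (β : X ⟶ X')
    {b : A} (y : Y.obj (op b)) (x : X.obj b) :
    Tensor.map α β (Tensor.tmul y x) = Tensor.tmul (α.app (op b) y) (β.app b x) :=
  rfl

theorem Tensor.ind {Y : Aᵒᵖ ⥤ Type u} {X : A ⥤ Type u} {P : Tensor Y X → Prop}
    (h : ∀ (b : A) (y : Y.obj (op b)) (x : X.obj b), P (Tensor.tmul y x)) (t : Tensor Y X) :
    P t :=
  Quot.ind (fun p => h p.1.1 p.1.2 p.2) t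

/-- The functor `- ⊗ X` from presheaves on `A` to sets. -/
def tensorRight (X : A ⥤ Type u) : (Aᵒᵖ ⥤ Type u) ⥤ Type u where
  obj Y := Tensor Y X
  map α := TypeCat.ofHom (Tensor.map α (𝟙 X))
  map_id Y := by
    ext t
    induction t using Tensor.ind
    simp [Tensor.map_tmul]
  map_comp α β := by
    ext t
    induction t using Tensor.ind
    simp [Tensor.map_tmul]

/-! ### Nondegenerate functors, modules, equational systems -/

/-- `X : A ⥤ Set` is nondegenerate if `- ⊗ X` preserves finite connected limits. -/
def Nondegenerate (X : A ⥤ Type u) : Prop :=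
  ∀ (J : Type) [SmallCategory J] [FinCategory J] [IsConnected J],
    PreservesLimitsOfShape J (tensorRight X)

/-- `X : A ⥤ Top` is nondegenerate if its underlying `Set`-valued functor is, and every
`X f` is a closed map. -/
def TopNondegenerate (X : A ⥤ TopCat.{u}) : Prop :=
  Nondegenerate (X ⋙ forget TopCat.{u}) ∧
    ∀ ⦃a a' : A⦄ (f : a ⟶ a'), IsClosedMap (fun x : X.obj a => X.map f x)

variable (A) in
/-- Modules `A ⇸ A`, that is, functors `Aᵒᵖ × A ⥤ Set`, in curried form: `M.obj a` is the
presheaf `M(-, a)`. -/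
abbrev EndoModule : Type (u + 1) := Profunctor.{u} A A

/-- The set `M(b, a)` of sectors `m : b ⇸ a`. -/
abbrev EndoModule.Sector (M : EndoModule A) (b a : A) : Type u := (M.obj a).obj (op b)

/-- `f m : b ⇸ a'`, for `m : b ⇸ a` and `f : a ⟶ a'`. -/
def EndoModule.lact (M : EndoModule A) {b a a' : A} (f : a ⟶ a') (m : M.Sector b a) : M.Sector b a' :=
  (M.map f).app (op b) m

/-- `m g : b' ⇸ a`, for `m : b ⇸ a` and `g : b' ⟶ b`. -/
def EndoModule.ract (M : EndoModule A) {b b' a : A} (m : M.Sector b a) (g : b' ⟶ b) : M.Sector b' a :=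
  (M.obj a).map g.op m

theorem EndoModule.one_lact (M : EndoModule A) {b a : A} (m : M.Sector b a) : M.lact (𝟙 a) m = m := by
  simp [EndoModule.lact]

theorem EndoModule.comp_lact (M : EndoModule A) {b a a' a'' : A} (f : a ⟶ a') (f' : a' ⟶ a'')
    (m : M.Sector b a) : M.lact (f ≫ f') m = M.lact f' (M.lact f m) := by
  simp [EndoModule.lact]

theorem EndoModule.ract_one (M : EndoModule A) {b a : A} (m : M.Sector b a) : M.ract m (𝟙 b) = m := by
  simp [EndoModule.ract]

theorem EndoModule.ract_comp (M : EndoModule A) {b b' b'' a : A} (m : M.Sector b a) (g : b' ⟶ b)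
    (g' : b'' ⟶ b') : M.ract m (g' ≫ g) = M.ract (M.ract m g) g' := by
  simp [EndoModule.ract]

theorem EndoModule.lact_ract (M : EndoModule A) {b b' a a' : A} (f : a ⟶ a') (m : M.Sector b a)
    (g : b' ⟶ b) : M.lact f (M.ract m g) = M.ract (M.lact f m) g :=
  NatTrans.naturality_apply (M.map f) g.op m

/-- An equational system `(A, M)`: for each `a` the category of elements of the presheaf
`M(-, a)` is finite, and for each `b` the functor `M(b, -)` is nondegenerate. -/
structure IsEquationalSystem (M : EndoModule A) : Prop where
  finite_obj : ∀ a : A, Finite (M.obj a).Elements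
  finite_hom : ∀ (a : A) (p q : (M.obj a).Elements), Finite (p ⟶ q)
  nondegenerate : ∀ b : A, Nondegenerate (M.flip.obj (op b))

/-! ### The endofunctor `M ⊗ -` in spaces and its coalgebras -/

/-- The topology on `Y ⊗ X` for space-valued `X`: the quotient topology from the topological
disjoint union of the spaces `X b`, one for each `(b, y)` with `y ∈ Y b`. -/
instance tensorTopology (Y : Aᵒᵖ ⥤ Type u) (X : A ⥤ TopCat.{u}) :
    TopologicalSpace (Tensor Y (X ⋙ forget TopCat.{u})) :=
  TopologicalSpace.coinduced
    (fun p : (Σ p : (Σ b : A, Y.obj (op b)), X.obj p.1) =>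
      (Tensor.tmul (X := X ⋙ forget TopCat.{u}) p.1.2 p.2))
    inferInstance

theorem continuous_tensorMap {Y Y' : Aᵒᵖ ⥤ Type u} {X X' : A ⥤ TopCat.{u}} (α : Y ⟶ Y')
    (β : X ⟶ X') :
    Continuous (Tensor.map α (Functor.whiskerRight β (forget TopCat.{u}))) := by
  rw [continuous_coinduced_dom]
  refine continuous_sigma fun p => ?_
  have h : Continuous (fun q : (Σ p : (Σ b : A, Y'.obj (op b)), X'.obj p.1) =>
      (Tensor.tmul (X := X' ⋙ forget TopCat.{u}) q.1.2 q.2)) := continuous_coinduced_rng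
  exact h.comp (continuous_sigmaMk (σ := fun p : (Σ b : A, Y'.obj (op b)) => X'.obj p.1)
    (i := ⟨p.1, α.app (op p.1) p.2⟩) |>.comp (β.app p.1).hom.continuous)

/-- The functor `M ⊗ X : A ⥤ Top`, `a ↦ M(-, a) ⊗ X`. -/
def modTensor (M : EndoModule A) (X : A ⥤ TopCat.{u}) : A ⥤ TopCat.{u} where
  obj a := TopCat.of (Tensor (M.obj a) (X ⋙ forget TopCat.{u}))
  map f := TopCat.ofHom ⟨_, continuous_tensorMap (M.map f) (𝟙 X)⟩
  map_id a := by
    ext t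
    induction t using Tensor.ind
    simp [Tensor.map_tmul]
  map_comp f g := by
    ext t
    induction t using Tensor.ind
    simp [Tensor.map_tmul]

/-- The endofunctor `M ⊗ -` of `[A, Top]`. -/
def modEndo (M : EndoModule A) : (A ⥤ TopCat.{u}) ⥤ (A ⥤ TopCat.{u}) where
  obj X := modTensor M X
  map β :=
    { app a := TopCat.ofHom ⟨_, continuous_tensorMap (𝟙 (M.obj a)) β⟩
      naturality a a' f := by
        ext t
        induction t using Tensor.ind
        rfl }
  map_id X := by
    ext a t
    induction t using Tensor.ind
    rfl
  map_comp β γ := by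
    ext a t
    induction t using Tensor.ind
    rfl

/-- The category of `M`-coalgebras in `Top`: nondegenerate functors `X : A ⥤ Top` with a natural
transformation `X ⟶ M ⊗ X`, and maps commuting with these.  (This is literally the category of
coalgebras for the restriction of `M ⊗ -` to the full subcategory of nondegenerate functors.) -/
abbrev TopCoalgebra (M : EndoModule A) : Type (u + 1) :=
  ObjectProperty.FullSubcategory
    (fun C : Endofunctor.Coalgebra (modEndo M) => TopNondegenerate C.V)

/-! ### Complexes -/

/-- A complex `⋯ ⇸ a₂ ⇸ a₁ ⇸ a₀ = a` ending at `a`.  Here `obj n` is `a_{n+1}`, `head` is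
`m₁ : a₁ ⇸ a` and `sec n` is `m_{n+2} : a_{n+2} ⇸ a_{n+1}`. -/
structure Cpx (M : EndoModule A) (a : A) : Type u where
  obj : ℕ → A
  head : M.Sector (obj 0) a
  sec : ∀ n, M.Sector (obj (n + 1)) (obj n)

namespace Cpx

variable {M : EndoModule A}

/-- A map of complexes `f_• : α ⟶ β` whose component `f₀` is the given `f : a ⟶ a'`;
`app n` is `f_{n+1}`. -/
@[ext]
structure HomOver {a a' : A} (f : a ⟶ a') (α : Cpx M a) (β : Cpx M a') : Type u where
  app : ∀ n, α.obj n ⟶ β.obj n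
  head_comm : M.lact f α.head = M.ract β.head (app 0)
  sec_comm : ∀ n, M.lact (app n) (α.sec n) = M.ract (β.sec n) (app (n + 1))

/-- The category of complexes ending at `a`; maps are maps of complexes with `f₀ = 1_a`. -/
instance category (a : A) : Category (Cpx M a) where
  Hom α β := HomOver (𝟙 a) α β
  id α :=
    { app := fun n => 𝟙 _
      head_comm := by rw [M.one_lact, M.ract_one]
      sec_comm := fun n => by rw [M.one_lact, M.ract_one] }
  comp {α β γ} φ ψ :=
    { app := fun n => φ.app n ≫ ψ.app n
      head_comm := by
        rw [M.ract_comp, ← ψ.head_comm, M.one_lact β.head, ← φ.head_comm]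
      sec_comm := fun n => by
        rw [M.comp_lact, φ.sec_comm, M.lact_ract, ψ.sec_comm, M.ract_comp] }

/-- The complex `⋯ ⇸ a₂ ⇸ a₁ ⇸ a'` with last sector `f m₁`. -/
@[simps]
def push {a a' : A} (f : a ⟶ a') (α : Cpx M a) : Cpx M a' where
  obj := α.obj
  head := M.lact f α.head
  sec := α.sec

theorem push_id {a : A} (α : Cpx M a) : push (𝟙 a) α = α := by
  cases α
  simp only [push, M.one_lact]

theorem push_comp {a a' a'' : A} (f : a ⟶ a') (g : a' ⟶ a'') (α : Cpx M a) :
    push (f ≫ g) α = push g (push f α) := by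
  simp only [push, M.comp_lact]

/-- `push f` as a functor from complexes ending at `a` to complexes ending at `a'`. -/
def pushFunctor {a a' : A} (f : a ⟶ a') : Cpx M a ⥤ Cpx M a' where
  obj := push f
  map {α β} φ :=
    { app := φ.app
      head_comm := by
        have h : α.head = M.ract β.head (φ.app 0) := (M.one_lact _).symm.trans φ.head_comm
        exact (M.one_lact _).trans ((congrArg (M.lact f) h).trans (M.lact_ract f _ _))
      sec_comm := φ.sec_comm }

/-- The complex `⋯ ⇸ b₂ ⇸ b₁ ⇸ b ⇸ a` obtained by adding a last sector `m : b ⇸ a`. -/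
def cons {b a : A} (m : M.Sector b a) (α : Cpx M b) : Cpx M a where
  obj
    | 0 => b
    | n + 1 => α.obj n
  head := m
  sec
    | 0 => α.head
    | n + 1 => α.sec n

/-- `cons m` as a functor from complexes ending at `b` to complexes ending at `a`. -/
def consFunctor {b a : A} (m : M.Sector b a) : Cpx M b ⥤ Cpx M a where
  obj := cons m
  map {α β} φ :=
    { app := fun
        | 0 => 𝟙 b
        | n + 1 => φ.app n
      head_comm := (M.one_lact m).trans (M.ract_one m).symm
      sec_comm := fun
        | 0 => φ.head_comm
        | n + 1 => φ.sec_comm n }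
  map_id α := by
    refine HomOver.ext (funext fun n => ?_)
    cases n <;> rfl
  map_comp φ ψ := by
    refine HomOver.ext (funext fun n => ?_)
    cases n with
    | zero => exact (Category.id_comp _).symm
    | succ n => rfl

/-- The complex `⋯ ⇸ a₂ ⇸ a₁` ending at `a₁`. -/
@[simps]
def tail {a : A} (α : Cpx M a) : Cpx M (α.obj 0) where
  obj n := α.obj (n + 1)
  head := α.sec 0
  sec n := α.sec (n + 1)

end Cpx

/-- The solvability condition: existence of a square (first part) and of a fork (second part)
whenever the maps `f₀, f₀'` can be prolonged to maps of complexes with a common codomain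
(respectively with common domain and codomain). -/
structure Solvable (M : EndoModule A) : Prop where
  square : ∀ {a a' b : A} (f : a ⟶ b) (f' : a' ⟶ b) (α : Cpx M a) (α' : Cpx M a') (β : Cpx M b),
    Nonempty (Cpx.HomOver f α β) → Nonempty (Cpx.HomOver f' α' β) →
      ∃ (c : A) (g : c ⟶ a) (g' : c ⟶ a'), g ≫ f = g' ≫ f'
  fork : ∀ {a b : A} (f f' : a ⟶ b) (α : Cpx M a) (β : Cpx M b),
    Nonempty (Cpx.HomOver f α β) → Nonempty (Cpx.HomOver f' α β) →
      ∃ (c : A) (g : c ⟶ a), g ≫ f = g ≫ f'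

/-! ### The functor `I` and its coalgebra structure -/

/-- `I(a)`: the set of connected components of the category of complexes ending at `a`. -/
def Univ (M : EndoModule A) (a : A) : Type u := ConnectedComponents (Cpx M a)

namespace Univ

variable {M : EndoModule A}

/-- The connected component `[α]` of a complex. -/
def mk {a : A} (α : Cpx M a) : Univ M a := Quotient.mk (Zigzag.setoid _) α

theorem ind {a : A} {P : Univ M a → Prop} (h : ∀ α, P (mk α)) (t : Univ M a) : P t :=
  Quotient.ind h t

theorem sound {a : A} {α β : Cpx M a} (φ : α ⟶ β) : mk α = mk β :=
  Quotient.sound (s := Zigzag.setoid _) (Zigzag.of_hom φ)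

/-- `I f : I(a) → I(a')`. -/
def map {a a' : A} (f : a ⟶ a') : Univ M a → Univ M a' :=
  (Cpx.pushFunctor f).mapConnectedComponents

theorem map_mk {a a' : A} (f : a ⟶ a') (α : Cpx M a) : map f (mk α) = mk (α.push f) := rfl

/-- A map of complexes over `f` witnesses `f [α] = [β]`. -/
theorem map_mk_of_homOver {a a' : A} {f : a ⟶ a'} {α : Cpx M a} {β : Cpx M a'}
    (φ : Cpx.HomOver f α β) : map f (mk α) = mk β :=
  sound (α := α.push f) (β := β)
    { app := φ.app
      head_comm := (M.one_lact _).trans φ.head_comm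
      sec_comm := φ.sec_comm }

/-- `φ_m : I(b) → I(a)`, adding the last sector `m : b ⇸ a`. -/
def cons {b a : A} (m : M.Sector b a) : Univ M b → Univ M a :=
  (Cpx.consFunctor m).mapConnectedComponents

end Univ

/-- The functor `I : A ⥤ Set`. -/
def univFunctor (M : EndoModule A) : A ⥤ Type u where
  obj a := Univ M a
  map f := TypeCat.ofHom (Univ.map f)
  map_id a := by
    ext t
    induction t using Univ.ind with
    | h α => exact congrArg Univ.mk (Cpx.push_id α)
  map_comp f g := by
    ext t
    induction t using Univ.ind with
    | h α => exact congrArg Univ.mk (Cpx.push_comp f g α)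

/-- `ι_a : I(a) → (M ⊗ I)(a)`, `[⋯ ⇸ a₂ ⇸ a₁ ⇸ a] ↦ m₁ ⊗ [⋯ ⇸ a₂ ⇸ a₁]`. -/
def univStr (M : EndoModule A) (a : A) : Univ M a → Tensor (M.obj a) (univFunctor M) :=
  Quotient.lift (s := Zigzag.setoid _)
    (fun α : Cpx M a => Tensor.tmul (X := univFunctor M) α.head (Univ.mk α.tail)) (by
      have key : ∀ {α β : Cpx M a} (φ : α ⟶ β),
          Tensor.tmul (Y := M.obj a) (X := univFunctor M) α.head (Univ.mk α.tail) =
            Tensor.tmul β.head (Univ.mk β.tail) := by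
        intro α β φ
        have h1 : α.head = M.ract β.head (φ.app 0) := (M.one_lact _).symm.trans φ.head_comm
        have h2 : Univ.map (φ.app 0) (Univ.mk α.tail) = Univ.mk β.tail :=
          Univ.map_mk_of_homOver (φ :=
            { app := fun n => φ.app (n + 1)
              head_comm := φ.sec_comm 0
              sec_comm := fun n => φ.sec_comm (n + 1) })
        rw [h1, ← h2]
        exact Tensor.tmul_glue (X := univFunctor M) (φ.app 0) β.head (Univ.mk α.tail)
      intro α β h
      induction h with
      | refl => rfl
      | tail _ h ih =>
        rcases h with ⟨⟨φ⟩⟩ | ⟨⟨φ⟩⟩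
        · exact ih.trans (key φ)
        · exact ih.trans (key φ).symm)

/-! ### The topology on `I(a)` -/

/-- Truncated complexes `a_n ⇸ ⋯ ⇸ a₁ ⇸ a₀ = a`, `n ≥ 0`. -/
inductive Trunc (M : EndoModule A) : A → Type u
  | nil (a : A) : Trunc M a
  | cons {b a : A} (m : M.Sector b a) (t : Trunc M b) : Trunc M a

/-- The set `V_{m₁, …, m_n} = φ_{m₁} ⋯ φ_{m_n} (I(a_n))`, consisting of the classes of those
complexes that end in the given truncated complex. -/
def Trunc.V {M : EndoModule A} : {a : A} → Trunc M a → Set (Univ M a)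
  | _, .nil _ => Set.univ
  | _, .cons m t => Univ.cons m '' t.V

/-- The coarsest topology on `I(a)` for which all sets `V_{m₁, …, m_n}` are closed. -/
instance univTopology (M : EndoModule A) (a : A) : TopologicalSpace (Univ M a) :=
  TopologicalSpace.generateFrom {U | ∃ t : Trunc M a, U = t.Vᶜ}

/-- `I` as a functor to spaces, given that all maps `I f` are continuous. -/
def univTop (M : EndoModule A)
    (hI : ∀ ⦃a a' : A⦄ (f : a ⟶ a'), Continuous (Univ.map f : Univ M a → Univ M a')) :
    A ⥤ TopCat.{u} where
  obj a := TopCat.of (Univ M a)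
  map f := TopCat.ofHom ⟨Univ.map f, hI f⟩
  map_id a := by
    ext t
    exact ConcreteCategory.congr_hom ((univFunctor M).map_id a) t
  map_comp f g := by
    ext t
    exact ConcreteCategory.congr_hom ((univFunctor M).map_comp f g) t

/-- `ι_a` as a map between the spaces `I(a)` and `(M ⊗ I)(a)`. -/
def univTopStr (M : EndoModule A)
    (hI : ∀ ⦃a a' : A⦄ (f : a ⟶ a'), Continuous (Univ.map f : Univ M a → Univ M a')) (a : A) :
    (univTop M hI).obj a → ((modEndo M).obj (univTop M hI)).obj a :=
  univStr M a

/-- `(I, ι)` as a coalgebra for `M ⊗ -` on `[A, Top]`, given that all maps `I f` and `ι_a` are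
continuous. -/
def univCoalgebra (M : EndoModule A)
    (hI : ∀ ⦃a a' : A⦄ (f : a ⟶ a'), Continuous (Univ.map f : Univ M a → Univ M a'))
    (hι : ∀ a : A, Continuous (univTopStr M hI a)) : Endofunctor.Coalgebra (modEndo M) where
  V := univTop M hI
  str :=
    { app a := TopCat.ofHom ⟨univTopStr M hI a, hι a⟩
      naturality a a' f := by
        ext t
        induction t using Univ.ind with
        | h α => rfl }

end

end SelfSim

/-!
The theorem rests on two finiteness arguments, both drawing on the finiteness of the categories
of elements of the presheaves `M(-, a)`.

*Spans of complexes.* Two complexes are joined by a span as soon as their truncations are joined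
by spans of every finite length: a span at one place extends to the next place in finitely many
ways, so König's lemma applies (`Cpx.exists_span_of_hasChain`). Under the solvability condition
this shows that components of complexes are connected by single spans
(`Cpx.exists_span_of_cospan`, `Univ.mk_eq_iff`) and that parallel maps of complexes can be
equalised (`Cpx.exists_fork_of_parallel`). Together with the nondegeneracy of the functors
`M(c, -)` this makes the category of elements of `I` complete cospans to squares and equalise
parallel pairs, which is equivalent to nondegeneracy
(`Nondegenerate.hasSquares`, `Nondegenerate.hasForks`,
`nondegenerate_of_hasSquares_of_hasForks`).

*Resolutions.* In a coalgebra `(X, ξ)` an element `x` is resolved along sectors `m₁, …, m_n` if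
`ξ x = m₁ ⊗ x₁`, `ξ x₁ = m₂ ⊗ x₂`, and so on. If for every `n` some element is resolved along the
`n`-truncations of two complexes, then these lie in one component (`SetCoalgebra.mk_eq_mk`). Hence
sending `x` to the component of any infinite resolution is well defined, and it is the only
coalgebra map `X → I`, because any such map sends the elements resolved along `m₁, …, m_n` into
`V_{m₁, …, m_n}`, and the sets `V` for the truncations of one complex meet in a single point.

*Topology.* An ultrafilter on `X a` can be resolved sector by sector, just like an element: there
is a complex such that the elements resolved along each of its truncations form a member of the
ultrafilter (`SetCoalgebra.exists_cpx_forall_resolved_mem`). For `X = I`, where being resolved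
along `t` means lying in `V_t`, the component of this complex is the unique limit of the
ultrafilter (`Univ.le_nhds_mk`, `Univ.eq_mk_of_le_nhds`). So `I(a)` is compact Hausdorff, and
continuity of maps into it can be read off from ultrafilters (`Univ.continuous_of_ultrafilter`).
For the map from a coalgebra `X` in spaces this needs the sets of resolved elements to be closed,
which is where the maps `X f` being closed is used (`isClosed_tmul_image`).
-/

namespace SelfSim

/-! ### Nondegenerate functors and their categories of elements -/

section Nondegenerate

variable {A : Type u} [SmallCategory A]

/-- Every cospan in the category of elements of `X` is completed by a span to a commuting square. -/
def HasSquares (X : A ⥤ Type u) : Prop :=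
  ∀ ⦃a a' b : A⦄ (f : a ⟶ b) (f' : a' ⟶ b) (x : X.obj a) (x' : X.obj a'),
    X.map f x = X.map f' x' →
      ∃ (c : A) (g : c ⟶ a) (g' : c ⟶ a') (z : X.obj c),
        g ≫ f = g' ≫ f' ∧ X.map g z = x ∧ X.map g' z = x'

/-- Every parallel pair in the category of elements of `X` is equalised by some arrow. -/
def HasForks (X : A ⥤ Type u) : Prop :=
  ∀ ⦃a b : A⦄ (f f' : a ⟶ b) (x : X.obj a), X.map f x = X.map f' x →
    ∃ (c : A) (g : c ⟶ a) (z : X.obj c), g ≫ f = g ≫ f' ∧ X.map g z = x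

theorem functor_map_comp {X : A ⥤ Type u} {a b c : A} (f : a ⟶ b) (g : b ⟶ c) (x : X.obj a) :
    X.map (f ≫ g) x = X.map g (X.map f x) := by
  simp

theorem functor_map_id {X : A ⥤ Type u} {a : A} (x : X.obj a) : X.map (𝟙 a) x = x := by
  simp

theorem Tensor.exists_rep {Y : Aᵒᵖ ⥤ Type u} {X : A ⥤ Type u} (t : Tensor Y X) :
    ∃ (b : A) (y : Y.obj (op b)) (x : X.obj b), Tensor.tmul y x = t := by
  induction t using Tensor.ind with
  | h b y x => exact ⟨b, y, x, rfl⟩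

/-- A span in the category of elements of `X` over which `y` and `y'` have a common restriction;
it witnesses `y ⊗ x = y' ⊗ x'`. -/
def TensorSpan {Y : Aᵒᵖ ⥤ Type u} {X : A ⥤ Type u} {b b' : A} (y : Y.obj (op b)) (x : X.obj b)
    (y' : Y.obj (op b')) (x' : X.obj b') : Prop :=
  ∃ (c : A) (g : c ⟶ b) (g' : c ⟶ b') (z : X.obj c),
    X.map g z = x ∧ X.map g' z = x' ∧ Y.map g.op y = Y.map g'.op y'

theorem TensorSpan.tmul_eq {Y : Aᵒᵖ ⥤ Type u} {X : A ⥤ Type u} {b b' : A} {y : Y.obj (op b)}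
    {x : X.obj b} {y' : Y.obj (op b')} {x' : X.obj b'} (h : TensorSpan y x y' x') :
    Tensor.tmul y x = Tensor.tmul y' x' := by
  obtain ⟨c, g, g', z, rfl, rfl, h⟩ := h
  rw [← Tensor.tmul_glue, h, Tensor.tmul_glue]

/-- If cospans of elements of `X` complete to squares, an equality `y ⊗ x = y' ⊗ x'` is witnessed
by a single span rather than a zigzag. -/
theorem tmul_eq_iff {Y : Aᵒᵖ ⥤ Type u} {X : A ⥤ Type u} (hX : HasSquares X) {b b' : A}
    {y : Y.obj (op b)} {x : X.obj b} {y' : Y.obj (op b')} {x' : X.obj b'} :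
    (Tensor.tmul y x : Tensor Y X) = Tensor.tmul y' x' ↔ TensorSpan y x y' x' := by
  refine ⟨fun h => ?_, TensorSpan.tmul_eq⟩
  have key : ∀ p q : PreTensor Y X, Relation.EqvGen (TensorRel Y X) p q →
      TensorSpan p.1.2 p.2 q.1.2 q.2 := by
    intro p q h
    induction h with
    | rel p q h =>
      obtain ⟨g, y, x⟩ := h
      exact ⟨_, 𝟙 _, g, x, functor_map_id x, rfl, by simp⟩
    | refl p => exact ⟨_, 𝟙 _, 𝟙 _, p.2, functor_map_id _, functor_map_id _, rfl⟩
    | symm p q _ ih =>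
      obtain ⟨c, g, g', z, h1, h2, h3⟩ := ih
      exact ⟨c, g', g, z, h2, h1, h3.symm⟩
    | trans p q r _ _ ih ih' =>
      obtain ⟨c, g, g', z, h1, h2, h3⟩ := ih
      obtain ⟨d, k, k', w, h4, h5, h6⟩ := ih'
      obtain ⟨e, l, l', v, h7, h8, h9⟩ := hX g' k z w (h2.trans h4.symm)
      refine ⟨e, l ≫ g, l' ≫ k', v, ?_, ?_, ?_⟩
      · rw [functor_map_comp, h8, h1]
      · rw [functor_map_comp, h9, h5]
      · rw [op_comp, functor_map_comp, h3, ← functor_map_comp, ← op_comp, h7, op_comp,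
          functor_map_comp, h6, ← functor_map_comp, ← op_comp]
  exact key ⟨⟨b, y⟩, x⟩ ⟨⟨b', y'⟩, x'⟩ (Quot.eqvGen_exact h)

/-- Finitely many properties of arrows `(d, w) ⟶ (c, z)` of elements, each stable under
precomposition and achievable after precomposition, can be achieved simultaneously. -/
theorem exists_refinement {X : A ⥤ Type u} {ι : Type*} [Finite ι] {c : A} (z : X.obj c)
    (P : ι → ∀ d : A, (d ⟶ c) → X.obj d → Prop)
    (stable : ∀ i d d' (e : d ⟶ c) (k : d' ⟶ d) (w : X.obj d'),
      P i d e (X.map k w) → P i d' (k ≫ e) w)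
    (dense : ∀ i d (e : d ⟶ c) (w : X.obj d), X.map e w = z →
      ∃ (d' : A) (k : d' ⟶ d) (w' : X.obj d'), X.map k w' = w ∧ P i d' (k ≫ e) w') :
    ∃ (d : A) (e : d ⟶ c) (w : X.obj d), X.map e w = z ∧ ∀ i, P i d e w := by
  classical
  have := Fintype.ofFinite ι
  suffices h : ∀ S : Finset ι, ∃ (d : A) (e : d ⟶ c) (w : X.obj d), X.map e w = z ∧
      ∀ i ∈ S, P i d e w by
    obtain ⟨d, e, w, h1, h2⟩ := h Finset.univ
    exact ⟨d, e, w, h1, fun i => h2 i (Finset.mem_univ i)⟩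
  intro S
  induction S using Finset.induction_on with
  | empty => exact ⟨c, 𝟙 c, z, functor_map_id z, by simp⟩
  | insert i S _ ih =>
    obtain ⟨d, e, w, h1, h2⟩ := ih
    obtain ⟨d', k, w', rfl, h4⟩ := dense i d e w h1
    refine ⟨d', k ≫ e, w', by rw [functor_map_comp, h1], fun j hj => ?_⟩
    rcases Finset.mem_insert.1 hj with rfl | hj
    · exact h4
    · exact stable j d d' e k w' (h2 j hj)

/-- An equality `y ⊗ x = y' ⊗ x` over the same `x` is witnessed by a single arrow of elements. -/
theorem tmul_eq_same {Y : Aᵒᵖ ⥤ Type u} {X : A ⥤ Type u} (hX : HasSquares X) (hX' : HasForks X)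
    {b : A} {y y' : Y.obj (op b)} {x : X.obj b}
    (h : (Tensor.tmul y x : Tensor Y X) = Tensor.tmul y' x) :
    ∃ (c : A) (g : c ⟶ b) (z : X.obj c), X.map g z = x ∧ Y.map g.op y = Y.map g.op y' := by
  obtain ⟨c, g, g', z, h1, h2, h3⟩ := (tmul_eq_iff hX).1 h
  obtain ⟨d, k, w, h4, h5⟩ := hX' g g' z (h1.trans h2.symm)
  refine ⟨d, k ≫ g, w, by rw [functor_map_comp, h5, h1], ?_⟩
  rw [op_comp, functor_map_comp, h3, ← functor_map_comp, ← op_comp, ← h4, op_comp]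

/-- `x` and `x'` lie in the same component of the category of elements of `X`. -/
def SpanConnected {X : A ⥤ Type u} {b b' : A} (x : X.obj b) (x' : X.obj b') : Prop :=
  ∃ (c : A) (g : c ⟶ b) (g' : c ⟶ b') (z : X.obj c), X.map g z = x ∧ X.map g' z = x'

theorem SpanConnected.symm {X : A ⥤ Type u} {b b' : A} {x : X.obj b} {x' : X.obj b'}
    (h : SpanConnected x x') : SpanConnected x' x := by
  obtain ⟨c, g, g', z, h1, h2⟩ := h
  exact ⟨c, g', g, z, h2, h1⟩

theorem SpanConnected.trans {X : A ⥤ Type u} (hX : HasSquares X) {b b' b'' : A} {x : X.obj b}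
    {x' : X.obj b'} {x'' : X.obj b''} (h : SpanConnected x x') (h' : SpanConnected x' x'') :
    SpanConnected x x'' := by
  obtain ⟨c, g, g', z, h1, h2⟩ := h
  obtain ⟨d, k, k', w, h4, h5⟩ := h'
  obtain ⟨e, l, l', v, _, h8, h9⟩ := hX g' k z w (h2.trans h4.symm)
  exact ⟨e, l ≫ g, l' ≫ k', v, by rw [functor_map_comp, h8, h1], by rw [functor_map_comp, h9, h5]⟩

/-- The map `A(-, a) ⊗ X → X a` of the co-Yoneda isomorphism, `g ⊗ x ↦ g x`. -/
def yonedaTensor (X : A ⥤ Type u) (a : A) : Tensor (yoneda.obj a) X → X.obj a :=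
  Quot.lift (fun p => X.map (show p.1.1 ⟶ a from p.1.2) p.2) (by
    rintro _ _ ⟨g, y, x⟩
    exact functor_map_comp (X := X) g y x)

theorem tmul_yoneda_eq {X : A ⥤ Type u} {a b : A} (g : b ⟶ a) (x : X.obj b) :
    (Tensor.tmul (Y := yoneda.obj a) g x : Tensor _ X) =
      Tensor.tmul (Y := yoneda.obj a) (𝟙 a) (X.map g x) := by
  rw [← Tensor.tmul_glue]
  congr 1
  exact (Category.comp_id g).symm

/-- Preservation of the pullback of two representables, read at the pair `(1 ⊗ x, 1 ⊗ x')`. -/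
theorem Nondegenerate.hasSquares {X : A ⥤ Type u} (hX : Nondegenerate X) : HasSquares X := by
  intro a a' b f f' x x' h
  have := hX WalkingCospan
  have hp := (IsPullback.of_hasPullback (yoneda.map f) (yoneda.map f')).map (tensorRight X)
  obtain ⟨t, ht1, ht2⟩ := Types.exists_of_isPullback hp
    (Tensor.tmul (Y := yoneda.obj a) (𝟙 a) x) (Tensor.tmul (Y := yoneda.obj a') (𝟙 a') x') (by
      change (Tensor.tmul (Y := yoneda.obj b) (𝟙 a ≫ f) x : Tensor _ X) =
        Tensor.tmul (Y := yoneda.obj b) (𝟙 a' ≫ f') x'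
      rw [Category.id_comp, Category.id_comp, tmul_yoneda_eq f x, tmul_yoneda_eq f' x', h])
  induction t using Tensor.ind with
  | h c p z =>
    refine ⟨c, (pullback.fst (yoneda.map f) (yoneda.map f')).app (op c) p,
      (pullback.snd (yoneda.map f) (yoneda.map f')).app (op c) p, z, ?_, ?_, ?_⟩
    · exact ConcreteCategory.congr_hom (NatTrans.congr_app
        (pullback.condition (f := yoneda.map f) (g := yoneda.map f')) (op c)) p
    · exact (congrArg (yonedaTensor X a) ht1).trans (functor_map_id x)
    · exact (congrArg (yonedaTensor X a') ht2).trans (functor_map_id x')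

/-- Preservation of the equaliser of two maps of representables, read at `1 ⊗ x`. -/
theorem Nondegenerate.hasForks {X : A ⥤ Type u} (hX : Nondegenerate X) : HasForks X := by
  intro a b f f' x h
  have := hX WalkingParallelPair
  have hp := isLimitForkMapOfIsLimit (tensorRight X) _
    (equalizerIsEqualizer (yoneda.map f) (yoneda.map f'))
  obtain ⟨t, ht, -⟩ := Types.unique_of_type_equalizer _ _ hp
    (Tensor.tmul (Y := yoneda.obj a) (𝟙 a) x) (by
      change (Tensor.tmul (Y := yoneda.obj b) (𝟙 a ≫ f) x : Tensor _ X) =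
        Tensor.tmul (Y := yoneda.obj b) (𝟙 a ≫ f') x
      rw [Category.id_comp, Category.id_comp, tmul_yoneda_eq f x, tmul_yoneda_eq f' x, h])
  induction t using Tensor.ind with
  | h c p z =>
    refine ⟨c, (equalizer.ι (yoneda.map f) (yoneda.map f')).app (op c) p, z, ?_, ?_⟩
    · exact ConcreteCategory.congr_hom (NatTrans.congr_app
        (equalizer.condition (yoneda.map f) (yoneda.map f')) (op c)) p
    · exact (congrArg (yonedaTensor X a) ht).trans (functor_map_id x)

/-- If the category of elements of `X` has squares and forks, each of its components is cofiltered,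
and `Y ⊗ X` is the disjoint union over the components of filtered colimits of values of `Y`.  The
proof argues with elements: a compatible family over a finite connected `J` is represented over a
single element of `X`, where it is a compatible family in the values of the presheaves. -/
theorem nondegenerate_of_hasSquares_of_hasForks {X : A ⥤ Type u} (hX : HasSquares X)
    (hX' : HasForks X) : Nondegenerate X := by
  intro J _ _ _
  have : Finite J := inferInstance
  have : Finite (Σ j k : J, j ⟶ k) := inferInstance
  refine ⟨fun {K} => ⟨fun {L} hL => ?_⟩⟩
  have hev : ∀ d : A, _ := fun d => (Types.isLimit_iff _).1
    ⟨isLimitOfPreserves ((evaluation Aᵒᵖ (Type u)).obj (op d)) hL⟩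
  obtain ⟨j₀⟩ : Nonempty J := inferInstance
  have hnat : ∀ (j : J) {d d' : A} (k : d' ⟶ d) (y : L.pt.obj (op d)),
      (L.π.app j).app (op d') (L.pt.map k.op y) = (K.obj j).map k.op ((L.π.app j).app (op d) y) :=
    fun j _ _ k y => NatTrans.naturality_apply (L.π.app j) k.op y
  have huniq : ∀ t t' : Tensor L.pt X,
      (∀ j, Tensor.map (L.π.app j) (𝟙 X) t = Tensor.map (L.π.app j) (𝟙 X) t') → t = t' := by
    intro t t' h
    induction t using Tensor.ind with | h b y x => ?_
    induction t' using Tensor.ind with | h b' y' x' => ?_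
    have h' : ∀ j, (Tensor.tmul ((L.π.app j).app (op b) y) x : Tensor (K.obj j) X) =
        Tensor.tmul ((L.π.app j).app (op b') y') x' := h
    -- a single component suffices to bring both tensors over the same element `z`
    obtain ⟨c, g, g', z, rfl, rfl, -⟩ := (tmul_eq_iff hX).1 (h' j₀)
    rw [← Tensor.tmul_glue, ← Tensor.tmul_glue] at h ⊢
    obtain ⟨d, k, w, rfl, hk⟩ := exists_refinement (ι := J) z
      (fun j d e _ => (L.π.app j).app (op d) (L.pt.map e.op (L.pt.map g.op y)) =
        (L.π.app j).app (op d) (L.pt.map e.op (L.pt.map g'.op y')))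
      (fun j d d' e k w h => by
        rw [op_comp, functor_map_comp, functor_map_comp]
        exact (hnat j k _).trans ((congrArg _ h).trans (hnat j k _).symm))
      (fun j d e w hw => by
        obtain ⟨d', k, w', h1, h2⟩ := tmul_eq_same hX hX' (x := w)
          (y := (L.π.app j).app (op d) (L.pt.map e.op (L.pt.map g.op y)))
          (y' := (L.π.app j).app (op d) (L.pt.map e.op (L.pt.map g'.op y'))) (by
            rw [hnat j e, hnat j e, Tensor.tmul_glue, Tensor.tmul_glue, hw]
            exact h j)
        refine ⟨d', k, w', h1, ?_⟩
        rw [op_comp, functor_map_comp, functor_map_comp]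
        exact (hnat j k _).trans (h2.trans (hnat j k _).symm))
    have hd : L.pt.map k.op (L.pt.map g.op y) = L.pt.map k.op (L.pt.map g'.op y') := by
      obtain ⟨l, -, hl⟩ := hev d
        (fun j => (L.π.app j).app (op d) (L.pt.map k.op (L.pt.map g.op y)))
        (fun {i j} u => ConcreteCategory.congr_hom (NatTrans.congr_app (L.w u) (op d)) _)
      exact (hl _ fun j => rfl).trans (hl _ fun j => (hk j).symm).symm
    rw [← Tensor.tmul_glue, ← Tensor.tmul_glue, hd]
  rw [Types.isLimit_iff]
  intro s hs
  choose b y x hyx using fun j => Tensor.exists_rep (s j)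
  have hcompat : ∀ {j k : J} (u : j ⟶ k),
      (Tensor.tmul ((K.map u).app (op (b j)) (y j)) (x j) : Tensor (K.obj k) X) =
        Tensor.tmul (y k) (x k) := by
    intro j k u
    rw [hyx k, ← hs u, ← hyx j]
    rfl
  -- as `J` is connected, all `x j` lie in one component of the category of elements
  have hconn : ∀ j, SpanConnected (x j₀) (x j) := by
    refine induct_on_objects {j | SpanConnected (x j₀) (x j)} ⟨_, 𝟙 _, 𝟙 _, x j₀,
      functor_map_id _, functor_map_id _⟩ (fun {j k} u => ?_)
    obtain ⟨c, g, g', z, h1, h2, -⟩ := (tmul_eq_iff hX).1 (hcompat u)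
    have h : SpanConnected (x j) (x k) := ⟨c, g, g', z, h1, h2⟩
    exact ⟨fun h' => h'.trans hX h, fun h' => h'.trans hX h.symm⟩
  -- hence all `x j` are images of one element `z`
  obtain ⟨c, e, z, hz, hg⟩ := exists_refinement (ι := J) (x j₀)
    (fun j d _ w => ∃ g : d ⟶ b j, X.map g w = x j)
    (fun j d d' _ k w ⟨g, hg⟩ => ⟨k ≫ g, by rw [functor_map_comp, hg]⟩)
    (fun j d e w hw => by
      obtain ⟨d', k, g, w', h1, h2⟩ :=
        SpanConnected.trans hX ⟨d, 𝟙 d, e, w, functor_map_id w, hw⟩ (hconn j)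
      exact ⟨d', k, w', h1, g, h2⟩)
  choose g hg using hg
  have hs' : ∀ j, (Tensor.tmul ((K.obj j).map (g j).op (y j)) z : Tensor (K.obj j) X) = s j := by
    intro j
    rw [Tensor.tmul_glue, hg, hyx]
  -- over a further refinement the representatives `y j` become compatible on the nose
  obtain ⟨d, k, w, hw, hk⟩ := exists_refinement (ι := Σ j k : J, j ⟶ k) z
    (fun u d e _ => (K.map u.2.2).app (op d)
        ((K.obj u.1).map e.op ((K.obj u.1).map (g u.1).op (y u.1))) =
      (K.obj u.2.1).map e.op ((K.obj u.2.1).map (g u.2.1).op (y u.2.1)))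
    (fun u d d' e k w h => by
      rw [op_comp, functor_map_comp, functor_map_comp, NatTrans.naturality_apply, h])
    (fun u d e w hw => by
      obtain ⟨d', k, w', h1, h2⟩ := tmul_eq_same hX hX' (x := w)
        (y := (K.map u.2.2).app (op d)
          ((K.obj u.1).map e.op ((K.obj u.1).map (g u.1).op (y u.1))))
        (y' := (K.obj u.2.1).map e.op ((K.obj u.2.1).map (g u.2.1).op (y u.2.1))) (by
          rw [Tensor.tmul_glue, hw, hs', ← hs u.2.2, ← hs' u.1, ← hw, ← Tensor.tmul_glue]
          rfl)
      refine ⟨d', k, w', h1, ?_⟩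
      rw [op_comp, functor_map_comp, functor_map_comp, NatTrans.naturality_apply, h2])
  obtain ⟨l, hl, -⟩ := hev d (fun j => (K.obj j).map k.op ((K.obj j).map (g j).op (y j)))
    (fun {i j} u => hk ⟨i, j, u⟩)
  refine ⟨Tensor.tmul (Y := L.pt) l w, fun j => ?_, fun t' ht' => ?_⟩
  · have h : (L.π.app j).app (op d) l = (K.obj j).map k.op ((K.obj j).map (g j).op (y j)) := hl j
    change (Tensor.tmul ((L.π.app j).app (op d) l) w : Tensor (K.obj j) X) = s j
    rw [h, Tensor.tmul_glue, hw, hs']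
  · refine huniq _ _ fun j => (ht' j).trans ?_
    have h : (L.π.app j).app (op d) l = (K.obj j).map k.op ((K.obj j).map (g j).op (y j)) := hl j
    change s j = (Tensor.tmul ((L.π.app j).app (op d) l) w : Tensor (K.obj j) X)
    rw [h, Tensor.tmul_glue, hw, hs']

end Nondegenerate

/-! ### Infinite paths in finitely branching systems -/

section Chains

variable {S : ℕ → Type*} (R : ∀ n, S n → S (n + 1) → Prop)

/-- `HasChain R N n s`: there is a chain of `N` successive `R`-steps starting at `s`, which sits at
level `n`. -/
def HasChain : ℕ → ∀ n, S n → Prop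
  | 0, _, _ => True
  | N + 1, n, s => ∃ s', R n s s' ∧ HasChain N (n + 1) s'

variable {R}

theorem HasChain.of_succ : ∀ {N n : ℕ} {s : S n}, HasChain R (N + 1) n s → HasChain R N n s
  | 0, _, _, _ => trivial
  | _ + 1, _, _, ⟨s', h, h'⟩ => ⟨s', h, HasChain.of_succ h'⟩

theorem HasChain.of_le {N N' n : ℕ} (h : N ≤ N') {s : S n} (hs : HasChain R N' n s) :
    HasChain R N n s := by
  induction N', h using Nat.le_induction with
  | base => exact hs
  | succ k _ ih => exact ih hs.of_succ

theorem exists_forall_hasChain {n : ℕ} {T : Set (S n)} (hT : T.Finite)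
    (h : ∀ N, ∃ s ∈ T, HasChain R N n s) : ∃ s ∈ T, ∀ N, HasChain R N n s := by
  by_contra! hc
  choose! N hN using hc
  obtain ⟨s, hs, hs'⟩ := h (hT.toFinset.sup N)
  exact hN s hs (hs'.of_le (Finset.le_sup (f := N) (hT.mem_toFinset.2 hs)))

/-- König's lemma, for the levelled relation `R` and a finite set `T` of starting points. -/
theorem exists_seq_of_hasChain (hR : ∀ n s, {s' | R n s s'}.Finite) {T : Set (S 0)} (hT : T.Finite)
    (h : ∀ N, ∃ s ∈ T, HasChain R N 0 s) :
    ∃ s : ∀ n, S n, s 0 ∈ T ∧ ∀ n, R n (s n) (s (n + 1)) := by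
  obtain ⟨s₀, hs₀, h₀⟩ := exists_forall_hasChain hT h
  have step : ∀ n (s : {s : S n // ∀ N, HasChain R N n s}),
      ∃ s' : {s : S (n + 1) // ∀ N, HasChain R N (n + 1) s}, R n s.1 s'.1 := by
    rintro n ⟨s, hs⟩
    obtain ⟨s', h1, h2⟩ := exists_forall_hasChain (hR n s) fun N => hs (N + 1)
    exact ⟨⟨s', h2⟩, h1⟩
  choose next hnext using step
  let seq : ∀ n, {s : S n // ∀ N, HasChain R N n s} := fun n => Nat.rec ⟨s₀, h₀⟩ next n
  exact ⟨fun n => (seq n).1, hs₀, fun n => hnext n (seq n)⟩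

end Chains

/-! ### Spans of complexes -/

section Spans

variable {A : Type u} [SmallCategory A] {M : EndoModule A}

namespace Cpx

variable {a a' c : A}

/-- A span from one object to the objects in place `n + 1` of two complexes. -/
abbrev Leg (α : Cpx M a) (β : Cpx M a') (n : ℕ) : Type u :=
  Σ c : A, (c ⟶ α.obj n) × (c ⟶ β.obj n)

/-- Some sector from the apex of `s'` to the apex of `s` commutes with the sectors `α.sec n` and
`β.sec n`. -/
def LegLink (α : Cpx M a) (β : Cpx M a') (n : ℕ) (s : Leg α β n) (s' : Leg α β (n + 1)) : Prop :=
  ∃ m : M.Sector s'.1 s.1, M.lact s.2.1 m = M.ract (α.sec n) s'.2.1 ∧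
    M.lact s.2.2 m = M.ract (β.sec n) s'.2.2

/-- Some sector from the apex of `s` to `c` commutes with the heads, over `f` and `f'`. -/
def LegBase (α : Cpx M a) (β : Cpx M a') (f : c ⟶ a) (f' : c ⟶ a') (s : Leg α β 0) : Prop :=
  ∃ m : M.Sector s.1 c, M.lact f m = M.ract α.head s.2.1 ∧ M.lact f' m = M.ract β.head s.2.2

/-- Finitely many sectors end at `c`, and a compatible arrow `d ⟶ b` is an arrow in the finite
category of elements of `M(-, a)`. -/
theorem finite_legs (hM : IsEquationalSystem M) {b b' : A} (f : c ⟶ a) (f' : c ⟶ a')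
    (p : M.Sector b a) (p' : M.Sector b' a') :
    {s : Σ d : A, (d ⟶ b) × (d ⟶ b') | ∃ m : M.Sector s.1 c,
      M.lact f m = M.ract p s.2.1 ∧ M.lact f' m = M.ract p' s.2.2}.Finite := by
  have h0 := hM.finite_obj c
  have key : ∀ {b a : A} (f : c ⟶ a) (p : M.Sector b a) (e : (M.obj c).Elements),
      Finite {g : e.1.unop ⟶ b // M.lact f e.2 = M.ract p g} := by
    intro b a f p e
    have := hM.finite_hom a ⟨op b, p⟩ ⟨e.1, M.lact f e.2⟩
    refine Finite.of_injective (fun g => CategoryOfElements.homMk (F := M.obj a)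
      ⟨op b, p⟩ ⟨e.1, M.lact f e.2⟩ g.1.op g.2.symm) ?_
    intro g g' h
    exact Subtype.ext (Quiver.Hom.op_inj (congrArg Subtype.val h))
  have h1 := fun e => key f p e
  have h2 := fun e => key f' p' e
  refine (Set.finite_range (fun t : Σ e : (M.obj c).Elements,
    {g : e.1.unop ⟶ b // M.lact f e.2 = M.ract p g} ×
      {g : e.1.unop ⟶ b' // M.lact f' e.2 = M.ract p' g} =>
    (⟨t.1.1.unop, t.2.1.1, t.2.2.1⟩ : Σ d : A, (d ⟶ b) × (d ⟶ b')))).subset ?_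
  rintro ⟨d, g, g'⟩ ⟨m, hm, hm'⟩
  exact ⟨⟨⟨op d, m⟩, ⟨g, hm⟩, ⟨g', hm'⟩⟩, rfl⟩

theorem exists_span_of_legs (α : Cpx M a) (β : Cpx M a') (f : c ⟶ a) (f' : c ⟶ a')
    (s : ∀ n, Leg α β n) (h0 : LegBase α β f f' (s 0))
    (h : ∀ n, LegLink α β n (s n) (s (n + 1))) :
    ∃ (δ : Cpx M c) (φ : HomOver f δ α) (ψ : HomOver f' δ β),
      ∀ n, (⟨δ.obj n, φ.app n, ψ.app n⟩ : Leg α β n) = s n := by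
  obtain ⟨m0, h0, h0'⟩ := h0
  choose m hm hm' using h
  exact ⟨⟨fun n => (s n).1, m0, m⟩, ⟨fun n => (s n).2.1, h0, hm⟩, ⟨fun n => (s n).2.2, h0', hm'⟩,
    fun n => rfl⟩

/-- Spans between the truncations of two complexes, of every finite length and with legs satisfying
`R`, give a span of complexes: only finitely many legs are linked to a given one. -/
theorem exists_span_of_hasChain (hM : IsEquationalSystem M) (α : Cpx M a) (β : Cpx M a')
    (f : c ⟶ a) (f' : c ⟶ a') (R : ∀ n, Leg α β n → Prop)
    (h : ∀ N, ∃ s : Leg α β 0, (LegBase α β f f' s ∧ R 0 s) ∧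
      HasChain (fun n s s' => LegLink α β n s s' ∧ R (n + 1) s') N 0 s) :
    ∃ (δ : Cpx M c) (φ : HomOver f δ α) (ψ : HomOver f' δ β),
      ∀ n, R n ⟨δ.obj n, φ.app n, ψ.app n⟩ := by
  obtain ⟨s, hs0, hs⟩ := exists_seq_of_hasChain
    (fun n s => (finite_legs hM s.2.1 s.2.2 (α.sec n) (β.sec n)).subset fun _ h => h.1)
    ((finite_legs hM f f' α.head β.head).subset fun _ h => h.1) h
  obtain ⟨δ, φ, ψ, h'⟩ := exists_span_of_legs α β f f' s hs0.1 fun n => (hs n).1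
  refine ⟨δ, φ, ψ, fun n => ?_⟩
  rw [h']
  cases n with
  | zero => exact hs0.2
  | succ n => exact (hs n).2

end Cpx

end Spans

/-! ### Solvability makes `I` nondegenerate -/

section Solvable

variable {A : Type u} [SmallCategory A] {M : EndoModule A}

theorem IsEquationalSystem.exists_square (hM : IsEquationalSystem M) {d a a' b : A} (f : a ⟶ b)
    (f' : a' ⟶ b) (m : M.Sector d a) (m' : M.Sector d a') (h : M.lact f m = M.lact f' m') :
    ∃ (c : A) (g : c ⟶ a) (g' : c ⟶ a') (p : M.Sector d c),
      g ≫ f = g' ≫ f' ∧ M.lact g p = m ∧ M.lact g' p = m' :=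
  (hM.nondegenerate d).hasSquares f f' m m' h

theorem IsEquationalSystem.exists_fork (hM : IsEquationalSystem M) {d a b : A} (f f' : a ⟶ b)
    (m : M.Sector d a) (h : M.lact f m = M.lact f' m) :
    ∃ (c : A) (g : c ⟶ a) (p : M.Sector d c), g ≫ f = g ≫ f' ∧ M.lact g p = m :=
  (hM.nondegenerate d).hasForks f f' m h

namespace Cpx

/-- The complex `⋯ ⇸ a_{n+2} ⇸ a_{n+1}` obtained by omitting the last `n + 1` sectors. -/
def drop {a : A} (α : Cpx M a) (n : ℕ) : Cpx M (α.obj n) where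
  obj k := α.obj (n + 1 + k)
  head := α.sec n
  sec k := α.sec (n + 1 + k)

/-- The map induced by a map of complexes on the complexes with `n + 1` sectors omitted. -/
def HomOver.drop {a a' : A} {f : a ⟶ a'} {α : Cpx M a} {β : Cpx M a'} (φ : HomOver f α β) (n : ℕ) :
    HomOver (φ.app n) (α.drop n) (β.drop n) where
  app k := φ.app (n + 1 + k)
  head_comm := φ.sec_comm n
  sec_comm k := φ.sec_comm (n + 1 + k)

theorem HomOver.lact_ract_sec {a a' : A} {f : a ⟶ a'} {α : Cpx M a} {β : Cpx M a'}
    (φ : HomOver f α β) (n : ℕ) {c : A} (g : c ⟶ α.obj (n + 1)) :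
    M.lact (φ.app n) (M.ract (α.sec n) g) = M.ract (β.sec n) (g ≫ φ.app (n + 1)) := by
  rw [M.lact_ract, φ.sec_comm, ← M.ract_comp]

theorem HomOver.lact_ract_head {a a' : A} {f : a ⟶ a'} {α : Cpx M a} {β : Cpx M a'}
    (φ : HomOver f α β) {c : A} (g : c ⟶ α.obj 0) :
    M.lact f (M.ract α.head g) = M.ract β.head (g ≫ φ.app 0) := by
  rw [M.lact_ract, φ.head_comm, ← M.ract_comp]

/-- A cospan of complexes ending at `a` is the lower half of a commuting square.  Its truncations
are filled in starting from the far end, where solvability supplies a commuting square, using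
nondegeneracy of the functors `M(c, -)` at every further place. -/
theorem exists_span_of_cospan (hM : IsEquationalSystem M) (hS : Solvable M) {a : A}
    {α β γ : Cpx M a} (φ : HomOver (𝟙 a) α γ) (ψ : HomOver (𝟙 a) β γ) :
    ∃ δ : Cpx M a, Nonempty (HomOver (𝟙 a) δ α) ∧ Nonempty (HomOver (𝟙 a) δ β) := by
  let R : ∀ n, Leg α β n → Prop := fun n s => s.2.1 ≫ φ.app n = s.2.2 ≫ ψ.app n
  have chain : ∀ N n, ∃ s : Leg α β n, R n s ∧
      HasChain (fun n s s' => LegLink α β n s s' ∧ R (n + 1) s') N n s := by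
    intro N
    induction N with
    | zero =>
      intro n
      obtain ⟨c, g, g', h⟩ := hS.square (φ.app n) (ψ.app n) (α.drop n) (β.drop n) (γ.drop n)
        ⟨φ.drop n⟩ ⟨ψ.drop n⟩
      exact ⟨⟨c, g, g'⟩, h, trivial⟩
    | succ N ih =>
      intro n
      obtain ⟨⟨d, k, k'⟩, h, hs⟩ := ih (n + 1)
      obtain ⟨c, g, g', m, h1, h2, h3⟩ := hM.exists_square (φ.app n) (ψ.app n)
        (M.ract (α.sec n) k) (M.ract (β.sec n) k') (by
          rw [φ.lact_ract_sec, ψ.lact_ract_sec]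
          exact congrArg _ h)
      exact ⟨⟨c, g, g'⟩, h1, ⟨d, k, k'⟩, ⟨⟨m, h2, h3⟩, h⟩, hs⟩
  obtain ⟨δ, φ', ψ', -⟩ := exists_span_of_hasChain hM α β (𝟙 a) (𝟙 a) R (by
    intro N
    obtain ⟨⟨d, k, k'⟩, h, hs⟩ := chain N 0
    -- `φ` and `ψ` are identities in place `0`, so the two composite sectors into `a` agree
    refine ⟨⟨d, k, k'⟩, ⟨⟨M.ract α.head k, M.one_lact _, ?_⟩, h⟩, hs⟩
    have h' : k ≫ φ.app 0 = k' ≫ ψ.app 0 := h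
    rw [φ.lact_ract_head, h', ← ψ.lact_ract_head, M.one_lact])
  exact ⟨δ, ⟨φ'⟩, ⟨ψ'⟩⟩

/-- Two parallel maps of complexes become equal in place `0` after composition with some map of
complexes. -/
theorem exists_fork_of_parallel (hM : IsEquationalSystem M) (hS : Solvable M) {a b : A}
    {f f' : a ⟶ b} {α : Cpx M a} {β : Cpx M b} (φ : HomOver f α β) (ψ : HomOver f' α β) :
    ∃ (c : A) (g : c ⟶ a) (δ : Cpx M c), g ≫ f = g ≫ f' ∧ Nonempty (HomOver g δ α) := by
  let R : ∀ n, Leg α α n → Prop :=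
    fun n s => s.2.1 = s.2.2 ∧ s.2.1 ≫ φ.app n = s.2.1 ≫ ψ.app n
  have chain : ∀ N n, ∃ s : Leg α α n, R n s ∧
      HasChain (fun n s s' => LegLink α α n s s' ∧ R (n + 1) s') N n s := by
    intro N
    induction N with
    | zero =>
      intro n
      obtain ⟨c, g, h⟩ := hS.fork (φ.app n) (ψ.app n) (α.drop n) (β.drop n)
        ⟨φ.drop n⟩ ⟨ψ.drop n⟩
      exact ⟨⟨c, g, g⟩, ⟨rfl, h⟩, trivial⟩
    | succ N ih =>
      intro n
      obtain ⟨⟨d, k, k'⟩, ⟨hk, h⟩, hs⟩ := ih (n + 1)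
      obtain rfl : k = k' := hk
      obtain ⟨c, g, m, h1, h2⟩ := hM.exists_fork (φ.app n) (ψ.app n) (M.ract (α.sec n) k) (by
        rw [φ.lact_ract_sec, ψ.lact_ract_sec]
        exact congrArg _ h)
      exact ⟨⟨c, g, g⟩, ⟨rfl, h1⟩, ⟨d, k, k⟩, ⟨⟨m, h2, h2⟩, rfl, h⟩, hs⟩
  obtain ⟨δ, χ, _, h⟩ := exists_span_of_hasChain hM α α (𝟙 a) (𝟙 a) R (by
    intro N
    obtain ⟨⟨d, k, k'⟩, ⟨hk, h⟩, hs⟩ := chain N 0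
    obtain rfl : k = k' := hk
    exact ⟨⟨d, k, k⟩, ⟨⟨M.ract α.head k, M.one_lact _, M.one_lact _⟩, rfl, h⟩, hs⟩)
  -- König's lemma only reaches place `1`; a fork for `M(δ.obj 0, -)` then equalises `f` and `f'`
  have hhead : δ.head = M.ract α.head (χ.app 0) := (M.one_lact _).symm.trans χ.head_comm
  obtain ⟨c, g, p, h1, h2⟩ := hM.exists_fork f f' δ.head (by
    rw [hhead, φ.lact_ract_head, ψ.lact_ract_head]
    exact congrArg _ (h 0).2)
  exact ⟨c, g, ⟨δ.obj, p, δ.sec⟩, h1, ⟨⟨χ.app, h2.trans hhead, χ.sec_comm⟩⟩⟩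

end Cpx

/-- Two complexes lie in the same component if and only if some complex maps to both. -/
theorem Univ.mk_eq_iff (hM : IsEquationalSystem M) (hS : Solvable M) {a : A} {α β : Cpx M a} :
    Univ.mk α = Univ.mk β ↔
      ∃ δ : Cpx M a, Nonempty (Cpx.HomOver (𝟙 a) δ α) ∧ Nonempty (Cpx.HomOver (𝟙 a) δ β) := by
  constructor
  · intro h
    have hz : Zigzag α β := Quotient.exact (s := Zigzag.setoid _) h
    clear h
    induction hz with
    | refl => exact ⟨α, ⟨𝟙 α⟩, ⟨𝟙 α⟩⟩
    | tail _ h ih =>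
      obtain ⟨δ, ⟨φ⟩, ⟨ψ⟩⟩ := ih
      rcases h with ⟨⟨χ⟩⟩ | ⟨⟨χ⟩⟩
      · exact ⟨δ, ⟨φ⟩, ⟨(show δ ⟶ _ from ψ) ≫ χ⟩⟩
      · obtain ⟨ε, ⟨κ⟩, ⟨l⟩⟩ := Cpx.exists_span_of_cospan hM hS ψ χ
        exact ⟨ε, ⟨(show ε ⟶ _ from κ) ≫ (show δ ⟶ _ from φ)⟩, ⟨l⟩⟩
  · rintro ⟨δ, ⟨φ⟩, ⟨ψ⟩⟩
    exact (Univ.sound (α := δ) φ).symm.trans (Univ.sound (α := δ) ψ)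

/-- Solving `f [α] = f' [α']` by complexes over a square: a complex mapping to `f α` and to `f' α'`
has its last sector lifted along `f` and `f'` because `M(c, -)` is nondegenerate. -/
theorem Univ.exists_homOver_of_map_eq (hM : IsEquationalSystem M) (hS : Solvable M) {a a' b : A}
    {f : a ⟶ b} {f' : a' ⟶ b} {α : Cpx M a} {α' : Cpx M a'}
    (h : Univ.map f (Univ.mk α) = Univ.map f' (Univ.mk α')) :
    ∃ (c : A) (g : c ⟶ a) (g' : c ⟶ a') (δ : Cpx M c), g ≫ f = g' ≫ f' ∧
      Nonempty (Cpx.HomOver g δ α) ∧ Nonempty (Cpx.HomOver g' δ α') := by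
  obtain ⟨δ, ⟨φ⟩, ⟨ψ⟩⟩ := (Univ.mk_eq_iff hM hS).1 h
  have h1 : M.lact (𝟙 b) δ.head = M.ract (M.lact f α.head) (φ.app 0) := φ.head_comm
  have h2 : M.lact (𝟙 b) δ.head = M.ract (M.lact f' α'.head) (ψ.app 0) := ψ.head_comm
  obtain ⟨c, g, g', p, h3, h4, h5⟩ := hM.exists_square f f' (M.ract α.head (φ.app 0))
    (M.ract α'.head (ψ.app 0)) 
    ((M.lact_ract f _ _).trans (h1.symm.trans (h2.trans (M.lact_ract f' _ _).symm)))
  exact ⟨c, g, g', ⟨δ.obj, p, δ.sec⟩, h3, ⟨⟨φ.app, h4, φ.sec_comm⟩⟩, ⟨⟨ψ.app, h5, ψ.sec_comm⟩⟩⟩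

theorem hasSquares_univFunctor (hM : IsEquationalSystem M) (hS : Solvable M) :
    HasSquares (univFunctor M) := by
  intro a a' b f f' x x' h
  induction x using Univ.ind with | h α => ?_
  induction x' using Univ.ind with | h α' => ?_
  obtain ⟨c, g, g', δ, h1, ⟨φ⟩, ⟨ψ⟩⟩ := Univ.exists_homOver_of_map_eq hM hS h
  exact ⟨c, g, g', Univ.mk δ, h1, Univ.map_mk_of_homOver φ, Univ.map_mk_of_homOver ψ⟩

theorem hasForks_univFunctor (hM : IsEquationalSystem M) (hS : Solvable M) :
    HasForks (univFunctor M) := by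
  intro a b f f' x h
  induction x using Univ.ind with | h α => ?_
  obtain ⟨c, g, g', δ, h1, ⟨φ⟩, ⟨ψ⟩⟩ := Univ.exists_homOver_of_map_eq hM hS h
  obtain ⟨d, k, ε, h2, ⟨χ⟩⟩ := Cpx.exists_fork_of_parallel hM hS φ ψ
  refine ⟨d, k ≫ g, Univ.mk ε, ?_, ?_⟩
  · rw [Category.assoc, h1, ← Category.assoc, ← h2]
  · exact (functor_map_comp (X := univFunctor M) k g (Univ.mk ε)).trans
      ((congrArg (Univ.map g) (Univ.map_mk_of_homOver χ)).trans (Univ.map_mk_of_homOver φ))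

theorem nondegenerate_univFunctor (hM : IsEquationalSystem M) (hS : Solvable M) :
    Nondegenerate (univFunctor M) :=
  nondegenerate_of_hasSquares_of_hasForks (hasSquares_univFunctor hM hS)
    (hasForks_univFunctor hM hS)

end Solvable

/-! ### Resolutions in set-valued coalgebras -/

section Resolutions

variable {A : Type u} [SmallCategory A] {M : EndoModule A}

/-- A coalgebra for `M ⊗ -` on set-valued functors, with no nondegeneracy condition. -/
structure SetCoalgebra (M : EndoModule A) where
  carrier : A ⥤ Type u
  str : ∀ a, carrier.obj a → Tensor (M.obj a) carrier
  naturality : ∀ {a a' : A} (f : a ⟶ a') (x : carrier.obj a),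
    str a' (carrier.map f x) = Tensor.map (M.map f) (𝟙 carrier) (str a x)

namespace Cpx

/-- The truncated complex formed by the `N` sectors `m_{n+1+N}, …, m_{n+2}`, ending at
`α.obj n = a_{n+1}`. -/
def truncFrom {a : A} (α : Cpx M a) : ℕ → ∀ n : ℕ, Trunc M (α.obj n)
  | 0, _ => .nil _
  | N + 1, n => .cons (α.sec n) (truncFrom α N (n + 1))

/-- The truncated complex formed by the last `N` sectors of a complex. -/
def trunc {a : A} (α : Cpx M a) : ℕ → Trunc M a
  | 0 => .nil _
  | N + 1 => .cons α.head (α.truncFrom N 0)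

theorem truncFrom_cons {b a : A} (m : M.Sector b a) (α : Cpx M b) (N n : ℕ) :
    (cons m α).truncFrom N (n + 1) = α.truncFrom N n := by
  induction N generalizing n with
  | zero => rfl
  | succ N ih => exact congrArg (Trunc.cons (α.sec n)) (ih (n + 1))

theorem trunc_cons {b a : A} (m : M.Sector b a) (α : Cpx M b) (N : ℕ) :
    (cons m α).trunc (N + 1) = .cons m (α.trunc N) := by
  cases N with
  | zero => rfl
  | succ N => exact congrArg (fun t => Trunc.cons m (Trunc.cons α.head t)) (truncFrom_cons m α N 0)

theorem truncFrom_push {a a' : A} (f : a ⟶ a') (α : Cpx M a) (N n : ℕ) :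
    (push f α).truncFrom N n = α.truncFrom N n := by
  induction N generalizing n with
  | zero => rfl
  | succ N ih => exact congrArg (Trunc.cons (α.sec n)) (ih (n + 1))

theorem trunc_push {a a' : A} (f : a ⟶ a') (α : Cpx M a) (N : ℕ) :
    (push f α).trunc (N + 1) = .cons (M.lact f α.head) (α.truncFrom N 0) :=
  congrArg (Trunc.cons (M.lact f α.head)) (truncFrom_push f α N 0)

/-- A complex is obtained by dependent choice from a relation `Rel m x y` such that each `x` admits
a sector `m` and a `y` at its source. -/
theorem exists_unfold {T : A → Type*} (Rel : ∀ {a b : A}, M.Sector b a → T a → T b → Prop)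
    (h : ∀ a (x : T a), ∃ (b : A) (m : M.Sector b a) (y : T b), Rel m x y) {a : A} (x : T a) :
    ∃ (α : Cpx M a) (y : ∀ n, T (α.obj n)), Rel α.head x (y 0) ∧
      ∀ n, Rel (α.sec n) (y n) (y (n + 1)) := by
  choose b m y hy using h
  let s : ℕ → Σ a, T a := fun n => Nat.rec ⟨a, x⟩ (fun _ p => ⟨b p.1 p.2, y p.1 p.2⟩) n
  exact ⟨⟨fun n => (s (n + 1)).1, m a x, fun n => m (s (n + 1)).1 (s (n + 1)).2⟩,
    fun n => (s (n + 1)).2, hy a x, fun n => hy (s (n + 1)).1 (s (n + 1)).2⟩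

end Cpx

namespace SetCoalgebra

variable (C : SetCoalgebra M)

/-- The elements `x` having a partial resolution along the truncated complex `m₁, …, m_n`: there are
`x = x₀, x₁, …, x_n` with structure map sending `x_i` to `m_{i+1} ⊗ x_{i+1}`. -/
def resolved : {a : A} → Trunc M a → Set (C.carrier.obj a)
  | _, .nil _ => Set.univ
  | _, .cons m t => {x | ∃ w ∈ resolved t, C.str _ x = Tensor.tmul m w}

variable {C}

theorem str_map_of_str_eq {a a' b : A} (f : a ⟶ a') {z : C.carrier.obj a} {p : M.Sector b a}
    {v : C.carrier.obj b} (h : C.str a z = Tensor.tmul p v) :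
    C.str a' (C.carrier.map f z) = Tensor.tmul (M.lact f p) v := by
  rw [C.naturality, h]
  rfl

/-- A decomposition `p ⊗ v` of `str z` can be refined so as to map to a given partial resolution of
`f z`. -/
theorem exists_refine (hC : HasSquares C.carrier) {c d a b : A} {z : C.carrier.obj c}
    {p : M.Sector d c} {v : C.carrier.obj d} (hz : C.str c z = Tensor.tmul p v) (f : c ⟶ a)
    {m : M.Sector b a} {t : Trunc M b} (hf : C.carrier.map f z ∈ C.resolved (.cons m t)) :
    ∃ (e : A) (r : e ⟶ d) (k : e ⟶ b) (v' : C.carrier.obj e), C.carrier.map r v' = v ∧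
      M.lact f (M.ract p r) = M.ract m k ∧ C.carrier.map k v' ∈ C.resolved t := by
  obtain ⟨w, hw, h⟩ := hf
  obtain ⟨e, r, k, v', h1, h2, h3⟩ :=
    (tmul_eq_iff hC).1 ((str_map_of_str_eq f hz).symm.trans h)
  exact ⟨e, r, k, v', h1, (M.lact_ract f p r).trans h3, h2.symm ▸ hw⟩

/-- Simultaneous refinement for two partial resolutions, of `f z` and of `f' z`. -/
theorem exists_refine₂ (hC : HasSquares C.carrier) {c a b a' b' : A} {z : C.carrier.obj c}
    (f : c ⟶ a) {m : M.Sector b a} {t : Trunc M b}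
    (hf : C.carrier.map f z ∈ C.resolved (.cons m t))
    (f' : c ⟶ a') {m' : M.Sector b' a'} {t' : Trunc M b'}
    (hf' : C.carrier.map f' z ∈ C.resolved (.cons m' t')) :
    ∃ (d : A) (p : M.Sector d c) (k : d ⟶ b) (k' : d ⟶ b') (v : C.carrier.obj d),
      M.lact f p = M.ract m k ∧ M.lact f' p = M.ract m' k' ∧
        C.carrier.map k v ∈ C.resolved t ∧ C.carrier.map k' v ∈ C.resolved t' := by
  obtain ⟨d, p, v, hz⟩ := (C.str c z).exists_rep
  obtain ⟨e, r, k, v', rfl, h1, h2⟩ := exists_refine hC hz.symm f hf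
  have hz' : C.str c z = Tensor.tmul (M.ract p r) v' := hz.symm.trans (Tensor.tmul_glue r p v').symm
  obtain ⟨e', r', k', v'', rfl, h3, h4⟩ := exists_refine hC hz' f' hf'
  refine ⟨e', M.ract (M.ract p r) r', r' ≫ k, k', v'', ?_, h3, ?_, h4⟩
  · rw [M.lact_ract, h1, M.ract_comp]
  · rwa [functor_map_comp]

/-- Two complexes lie in the same component as soon as, for every `N`, some element is resolved
along the last `N` sectors of either: each such element yields a span between the truncations. -/
theorem mk_eq_mk (hM : IsEquationalSystem M) (hC : HasSquares C.carrier) {a : A} {α β : Cpx M a}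
    (h : ∀ N, (C.resolved (α.trunc N) ∩ C.resolved (β.trunc N)).Nonempty) :
    Univ.mk α = Univ.mk β := by
  have chain : ∀ N n (s : Cpx.Leg α β n) (z : C.carrier.obj s.1),
      C.carrier.map s.2.1 z ∈ C.resolved (α.truncFrom N n) →
      C.carrier.map s.2.2 z ∈ C.resolved (β.truncFrom N n) →
      HasChain (fun n s s' => Cpx.LegLink α β n s s' ∧ True) N n s := by
    intro N
    induction N with
    | zero => exact fun _ _ _ _ _ => trivial
    | succ N ih =>
      rintro n ⟨c, g, g'⟩ z hg hg'
      obtain ⟨d, p, k, k', v, h1, h2, h3, h4⟩ := exists_refine₂ hC g hg g' hg'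
      exact ⟨⟨d, k, k'⟩, ⟨⟨p, h1, h2⟩, trivial⟩, ih _ _ v h3 h4⟩
  obtain ⟨δ, φ, ψ, -⟩ := Cpx.exists_span_of_hasChain hM α β (𝟙 a) (𝟙 a) (fun _ _ => True) (by
    intro N
    obtain ⟨x, hx, hx'⟩ := h (N + 1)
    obtain ⟨d, p, k, k', v, h1, h2, h3, h4⟩ := exists_refine₂ hC (z := x) (𝟙 a)
      (by rw [functor_map_id]; exact hx) (𝟙 a) (by rw [functor_map_id]; exact hx')
    exact ⟨⟨d, k, k'⟩, ⟨⟨p, h1, h2⟩, trivial⟩, chain _ _ _ v h3 h4⟩)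
  exact (Univ.sound (α := δ) φ).symm.trans (Univ.sound (α := δ) ψ)

/-- One step of the resolution of an ultrafilter: only finitely many sectors end at `a`. -/
theorem exists_ultrafilter_step (hM : IsEquationalSystem M) (C : SetCoalgebra M) {a : A}
    (F : Ultrafilter (C.carrier.obj a)) :
    ∃ (b : A) (m : M.Sector b a) (G : Ultrafilter (C.carrier.obj b)),
      ∀ W ∈ G, {x | ∃ w ∈ W, C.str a x = Tensor.tmul m w} ∈ F := by
  have := hM.finite_obj a
  have hcover : ∀ᶠ x in F, ∃ (e : (M.obj a).Elements) (w : C.carrier.obj e.1.unop),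
      C.str a x = Tensor.tmul (b := e.1.unop) e.2 w := by
    refine Filter.Eventually.of_forall fun x => ?_
    obtain ⟨b, m, w, h⟩ := (C.str a x).exists_rep
    exact ⟨⟨op b, m⟩, w, h.symm⟩
  obtain ⟨⟨⟨b⟩, m⟩, hb⟩ := Ultrafilter.eventually_exists_iff.1 hcover
  -- lift `F` to an ultrafilter on the relation `C.str a x = m ⊗ w`, and project to the factor `w`
  have hb' : (Prod.fst : C.carrier.obj a × C.carrier.obj b → _) ''
      {q | C.str a q.1 = Tensor.tmul (b := b) m q.2} ∈ F := by
    filter_upwards [hb] with x hx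
    obtain ⟨w, hw⟩ := hx
    exact ⟨(x, w), hw, rfl⟩
  refine ⟨b, m, (Ultrafilter.ofComapInfPrincipal hb').map Prod.snd, fun W hW => ?_⟩
  rw [← Ultrafilter.ofComapInfPrincipal_eq_of_map hb', Ultrafilter.mem_map]
  filter_upwards [Ultrafilter.ofComapInfPrincipal_mem hb', hW] with q hq hq'
  exact ⟨q.2, hq', hq⟩

/-- Every ultrafilter concentrates on the elements resolved along the truncations of one complex. -/
theorem exists_cpx_forall_resolved_mem (hM : IsEquationalSystem M) (C : SetCoalgebra M) {a : A}
    (F : Ultrafilter (C.carrier.obj a)) :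
    ∃ α : Cpx M a, ∀ N, C.resolved (α.trunc N) ∈ F := by
  obtain ⟨α, G, h0, h⟩ := Cpx.exists_unfold (M := M) (T := fun a => Ultrafilter (C.carrier.obj a))
    (fun {a b} m F G => ∀ W ∈ G, {x | ∃ w ∈ W, C.str a x = Tensor.tmul m w} ∈ F)
    (fun a F => exists_ultrafilter_step hM C F) F
  have key : ∀ N n, C.resolved (α.truncFrom N n) ∈ G n := by
    intro N
    induction N with
    | zero => exact fun n => Filter.univ_mem
    | succ N ih => exact fun n => h n _ (ih (n + 1))
  refine ⟨α, fun N => ?_⟩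
  cases N with
  | zero => exact Filter.univ_mem
  | succ N => exact h0 _ (key N 0)

/-- The case of a principal ultrafilter: every element has an infinite resolution. -/
theorem exists_resolution (hM : IsEquationalSystem M) (C : SetCoalgebra M) {a : A}
    (x : C.carrier.obj a) : ∃ α : Cpx M a, ∀ N, x ∈ C.resolved (α.trunc N) :=
  exists_cpx_forall_resolved_mem hM C (pure x)

end SetCoalgebra

end Resolutions

/-! ### The coalgebra `(I, ι)` in sets -/

section UnivCoalgebra

variable {A : Type u} [SmallCategory A] {M : EndoModule A}

namespace Cpx

theorem truncFrom_tail {a : A} (α : Cpx M a) (N n : ℕ) :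
    α.tail.truncFrom N n = α.truncFrom N (n + 1) := by
  induction N generalizing n with
  | zero => rfl
  | succ N ih => exact congrArg (Trunc.cons (α.sec (n + 1))) (ih (n + 1))

theorem trunc_succ {a : A} (α : Cpx M a) (N : ℕ) :
    α.trunc (N + 1) = .cons α.head (α.tail.trunc N) := by
  cases N with
  | zero => rfl
  | succ N =>
    exact congrArg (fun t => Trunc.cons α.head (Trunc.cons (α.sec 0) t)) (truncFrom_tail α N 0).symm

end Cpx

namespace Univ

theorem map_cons {a a' b : A} (f : a ⟶ a') (m : M.Sector b a) (x : Univ M b) :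
    map f (cons m x) = cons (M.lact f m) x := by
  induction x using Univ.ind with
  | h α =>
    refine sound (α := (α.cons m).push f) (β := α.cons (M.lact f m)) ⟨fun n => 𝟙 _, ?_, fun n => ?_⟩
    · exact (M.one_lact _).trans (M.ract_one _).symm
    · exact (M.one_lact _).trans (M.ract_one _).symm

theorem cons_ract {a b b' : A} (m : M.Sector b a) (g : b' ⟶ b) (x : Univ M b') :
    cons (M.ract m g) x = cons m (map g x) := by
  induction x using Univ.ind with
  | h α =>
    refine sound (α := α.cons (M.ract m g)) (β := (α.push g).cons m)
      ⟨fun | 0 => g | n + 1 => 𝟙 _, M.one_lact _, fun | 0 => ?_ | n + 1 => ?_⟩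
    · exact (M.ract_one _).symm
    · exact (M.one_lact _).trans (M.ract_one _).symm

/-- The complexes `α` and `cons α.head α.tail` agree in each place, but only up to a case
distinction on the place, so they are compared by identity arrows. -/
theorem cons_head_tail {a : A} (α : Cpx M a) : cons α.head (mk α.tail) = mk α := by
  refine sound (α := α.tail.cons α.head) (β := α)
    ⟨fun | 0 => 𝟙 _ | n + 1 => 𝟙 _, ?_, fun | 0 => ?_ | n + 1 => ?_⟩
  all_goals exact (M.one_lact _).trans (M.ract_one _).symm

theorem str_cons {a b : A} (m : M.Sector b a) (x : Univ M b) :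
    univStr M a (cons m x) = Tensor.tmul (X := univFunctor M) m x := by
  induction x using Univ.ind with
  | h α => rfl

/-- The inverse `m ⊗ [α] ↦ [⋯ ⇸ b ⇸ a]` of `ι_a`. -/
def ofTensor (a : A) : Tensor (M.obj a) (univFunctor M) → Univ M a :=
  Quot.lift (fun p => cons (b := p.1.1) p.1.2 p.2) (by
    rintro _ _ ⟨g, m, x⟩
    exact cons_ract m g x)

theorem ofTensor_str {a : A} (x : Univ M a) : ofTensor a (univStr M a x) = x := by
  induction x using Univ.ind with
  | h α => exact cons_head_tail α

theorem str_ofTensor {a : A} (t : Tensor (M.obj a) (univFunctor M)) :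
    univStr M a (ofTensor a t) = t := by
  induction t using Tensor.ind with
  | h b m x => exact str_cons (b := b) m x

theorem str_eq_tmul_iff {a b : A} {m : M.Sector b a} {x : Univ M a} {y : Univ M b} :
    univStr M a x = Tensor.tmul (X := univFunctor M) m y ↔ cons m y = x := by
  constructor
  · intro h
    rw [← ofTensor_str x, h]
    rfl
  · rintro rfl
    exact str_cons m y

end Univ

variable (M) in
/-- The coalgebra `(I, ι)` in sets. -/
def univSetCoalgebra : SetCoalgebra M where
  carrier := univFunctor M
  str := univStr M
  naturality f x := by
    induction x using Univ.ind with
    | h α => rfl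

/-- In `I`, being resolved along `t` means lying in `V_t`. -/
theorem resolved_univSetCoalgebra {a : A} (t : Trunc M a) :
    (univSetCoalgebra M).resolved t = t.V := by
  induction t with
  | nil => rfl
  | cons m t ih =>
    ext x
    change (∃ w ∈ (univSetCoalgebra M).resolved t, univStr M _ x = Tensor.tmul m w) ↔
      ∃ w ∈ t.V, Univ.cons m w = x
    rw [ih]
    exact exists_congr fun w => and_congr_right fun _ => Univ.str_eq_tmul_iff

namespace Univ

theorem mk_mem_V {a : A} (α : Cpx M a) (N : ℕ) : mk α ∈ (α.trunc N).V := by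
  induction N generalizing a with
  | zero => trivial
  | succ N ih =>
    rw [Cpx.trunc_succ]
    exact ⟨mk α.tail, ih α.tail, cons_head_tail α⟩

/-- The sets `V` cut out by the truncations of a complex meet in a single point. -/
theorem eq_mk_of_forall_mem_V (hM : IsEquationalSystem M) (hS : Solvable M) {a : A} {x : Univ M a}
    {α : Cpx M a} (h : ∀ N, x ∈ (α.trunc N).V) : x = mk α := by
  induction x using Univ.ind with
  | h β =>
    refine SetCoalgebra.mk_eq_mk (C := univSetCoalgebra M) hM (hasSquares_univFunctor hM hS)
      fun N => ⟨mk β, ?_, ?_⟩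
    · rw [resolved_univSetCoalgebra]
      exact mk_mem_V β N
    · rw [resolved_univSetCoalgebra]
      exact h N

end Univ

end UnivCoalgebra

/-! ### The topology on `I` -/

section UnivTopology

variable {A : Type u} [SmallCategory A] {M : EndoModule A}

open Topology

theorem Trunc.isClosed_V {a : A} (t : Trunc M a) : IsClosed t.V :=
  isOpen_compl_iff.1 (TopologicalSpace.isOpen_generateFrom_of_mem ⟨t, rfl⟩)

namespace Univ

theorem exists_cpx_forall_V_mem (hM : IsEquationalSystem M) {a : A} (F : Ultrafilter (Univ M a)) :
    ∃ α : Cpx M a, ∀ N, (α.trunc N).V ∈ F := by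
  obtain ⟨α, h⟩ := SetCoalgebra.exists_cpx_forall_resolved_mem hM (univSetCoalgebra M) F
  exact ⟨α, fun N => resolved_univSetCoalgebra (α.trunc N) ▸ h N⟩

/-- If an ultrafilter contains `V_t`, the complex on whose truncations it concentrates can be chosen
to end in `t`. -/
theorem exists_cpx_forall_V_mem_of_V_mem (hM : IsEquationalSystem M) {a : A} (t : Trunc M a)
    (F : Ultrafilter (Univ M a)) (ht : t.V ∈ F) :
    ∃ α : Cpx M a, mk α ∈ t.V ∧ ∀ N, (α.trunc N).V ∈ F := by
  induction t with
  | nil a =>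
    obtain ⟨α, h⟩ := exists_cpx_forall_V_mem hM F
    exact ⟨α, trivial, h⟩
  | cons m t ih =>
    obtain ⟨α, h1, h2⟩ := ih _ (Ultrafilter.ofComapInfPrincipal_mem ht)
    refine ⟨α.cons m, ⟨_, h1, rfl⟩, fun N => ?_⟩
    cases N with
    | zero => exact Filter.univ_mem
    | succ N =>
      rw [Cpx.trunc_cons, ← Ultrafilter.ofComapInfPrincipal_eq_of_map ht, Ultrafilter.mem_map]
      filter_upwards [h2 N] with x hx
      exact ⟨x, hx, rfl⟩

/-- An ultrafilter concentrating on the truncations of `α` converges to `[α]`: if it contains `V_t`,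
it concentrates on the truncations of a complex ending in `t`, and that complex lies in the
component of `α`. -/
theorem le_nhds_mk (hM : IsEquationalSystem M) (hS : Solvable M) {a : A}
    {F : Ultrafilter (Univ M a)} {α : Cpx M a} (h : ∀ N, (α.trunc N).V ∈ F) :
    (F : Filter (Univ M a)) ≤ 𝓝 (mk α) := by
  refine (TopologicalSpace.tendsto_nhds_generateFrom_iff (m := id)).2 ?_
  rintro _ ⟨t, rfl⟩ hα
  refine Ultrafilter.compl_mem_iff_notMem.2 fun ht => hα ?_
  obtain ⟨β, hβ, hF⟩ := exists_cpx_forall_V_mem_of_V_mem hM t F ht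
  have : mk β = mk α := SetCoalgebra.mk_eq_mk (C := univSetCoalgebra M) hM
    (hasSquares_univFunctor hM hS) fun N => by
      rw [resolved_univSetCoalgebra, resolved_univSetCoalgebra]
      exact Ultrafilter.nonempty_of_mem (Filter.inter_mem (hF N) (h N))
  exact this ▸ hβ

theorem compactSpace (hM : IsEquationalSystem M) (hS : Solvable M) (a : A) :
    CompactSpace (Univ M a) := by
  refine ⟨isCompact_iff_ultrafilter_le_nhds.2 fun F _ => ?_⟩
  obtain ⟨α, h⟩ := exists_cpx_forall_V_mem hM F
  exact ⟨mk α, trivial, le_nhds_mk hM hS h⟩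

theorem eq_mk_of_le_nhds (hM : IsEquationalSystem M) (hS : Solvable M) {a : A}
    {F : Ultrafilter (Univ M a)} {x : Univ M a} (hx : (F : Filter (Univ M a)) ≤ 𝓝 x) {α : Cpx M a}
    (h : ∀ N, (α.trunc N).V ∈ F) : x = mk α :=
  eq_mk_of_forall_mem_V hM hS fun N =>
    isClosed_iff_ultrafilter.1 (α.trunc N).isClosed_V x F hx (h N)

theorem t2Space (hM : IsEquationalSystem M) (hS : Solvable M) (a : A) : T2Space (Univ M a) := by
  refine t2_iff_ultrafilter.2 fun {x y} F hx hy => ?_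
  obtain ⟨α, h⟩ := exists_cpx_forall_V_mem hM F
  exact (eq_mk_of_le_nhds hM hS hx h).trans (eq_mk_of_le_nhds hM hS hy h).symm

/-- A criterion for continuity of a map into `I(a)`. -/
theorem continuous_of_ultrafilter (hM : IsEquationalSystem M) (hS : Solvable M) {a : A} {X : Type*}
    [TopologicalSpace X] {φ : X → Univ M a}
    (h : ∀ (x : X) (F : Ultrafilter X), (F : Filter X) ≤ 𝓝 x →
      ∃ α : Cpx M a, φ x = mk α ∧ ∀ N, φ ⁻¹' (α.trunc N).V ∈ F) : Continuous φ := by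
  refine continuous_iff_ultrafilter.2 fun x F hF => ?_
  obtain ⟨α, hα, hN⟩ := h x F hF
  rw [hα]
  exact le_nhds_mk hM hS (F := F.map φ) hN

theorem continuous_map (hM : IsEquationalSystem M) (hS : Solvable M) {a a' : A} (f : a ⟶ a') :
    Continuous (map f : Univ M a → Univ M a') := by
  refine continuous_of_ultrafilter hM hS fun x F hF => ?_
  obtain ⟨α, h⟩ := exists_cpx_forall_V_mem hM F
  refine ⟨α.push f, congrArg (map f) (eq_mk_of_le_nhds hM hS hF h), fun N => ?_⟩
  cases N with
  | zero => exact Filter.univ_mem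
  | succ N =>
    rw [Cpx.trunc_push]
    filter_upwards [h (N + 1)] with _ ⟨y, hy, hxy⟩
    exact ⟨y, hy, (map_cons f _ y).symm.trans (congrArg (map f) hxy)⟩

theorem continuous_cons (hM : IsEquationalSystem M) (hS : Solvable M) {a b : A}
    (m : M.Sector b a) : Continuous (cons m) := by
  refine continuous_of_ultrafilter hM hS fun x F hF => ?_
  obtain ⟨α, h⟩ := exists_cpx_forall_V_mem hM F
  refine ⟨α.cons m, congrArg (cons m) (eq_mk_of_le_nhds hM hS hF h), fun N => ?_⟩
  cases N with
  | zero => exact Filter.univ_mem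
  | succ N =>
    rw [Cpx.trunc_cons]
    filter_upwards [h N] with x hx
    exact ⟨x, hx, rfl⟩

/-- `ι_a` is continuous, as the inverse of a continuous bijection from a compact space to a
Hausdorff space. -/
theorem continuous_univTopStr (hM : IsEquationalSystem M) (hS : Solvable M)
    (hI : ∀ ⦃a a' : A⦄ (f : a ⟶ a'), Continuous (map f : Univ M a → Univ M a')) (a : A) :
    Continuous (univTopStr M hI a) := by
  have := t2Space hM hS a
  have : ∀ b, CompactSpace ((univTop M hI).obj b) := fun b => compactSpace hM hS b
  have : Finite (Σ b : A, (M.obj a).obj (op b)) := by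
    have := hM.finite_obj a
    exact Finite.of_injective (β := (M.obj a).Elements) (fun p => ⟨op p.1, p.2⟩) (by
      rintro ⟨b, m⟩ ⟨b', m'⟩ h
      cases h
      rfl)
  have hq : Continuous fun p : (Σ p : (Σ b : A, (M.obj a).obj (op b)), (univTop M hI).obj p.1) =>
      (Tensor.tmul (X := univTop M hI ⋙ forget TopCat.{u}) p.1.2 p.2) := continuous_coinduced_rng
  have : CompactSpace (Tensor (M.obj a) (univTop M hI ⋙ forget TopCat.{u})) := by
    refine ⟨?_⟩
    rw [← Set.range_eq_univ.2 (fun t => ?_)]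
    · exact isCompact_range hq
    · obtain ⟨b, m, x, h⟩ := t.exists_rep
      exact ⟨⟨⟨b, m⟩, x⟩, h⟩
  let e : Tensor (M.obj a) (univTop M hI ⋙ forget TopCat.{u}) ≃ Univ M a :=
    { toFun := ofTensor a
      invFun := univStr M a
      left_inv := str_ofTensor
      right_inv := ofTensor_str }
  have he : Continuous e :=
    continuous_coinduced_dom.2 (continuous_sigma fun p => continuous_cons hM hS (b := p.1) p.2)
  exact he.continuous_symm_of_equiv_compact_to_t2

end Univ

end UnivTopology

/-! ### Maps from coalgebras to `(I, ι)` -/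

section Terminal

variable {A : Type u} [SmallCategory A] {M : EndoModule A}

namespace SetCoalgebra

variable (C : SetCoalgebra M)

/-- Any map commuting with the structure maps sends elements resolved along `t` into `V_t`. -/
theorem mem_V_of_mem_resolved {k : ∀ a, C.carrier.obj a → Univ M a}
    (hk : ∀ {a b : A} {x : C.carrier.obj a} {m : M.Sector b a} {w : C.carrier.obj b},
      C.str a x = Tensor.tmul m w → k a x = Univ.cons m (k b w))
    {a : A} {t : Trunc M a} {x : C.carrier.obj a} (hx : x ∈ C.resolved t) : k a x ∈ t.V := by
  induction t with
  | nil => trivial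
  | cons m t ih =>
    obtain ⟨w, hw, h⟩ := hx
    exact ⟨k _ w, ih hw, (hk h).symm⟩

/-- The map to `I` sending an element to the component of its resolutions. -/
noncomputable def toUniv (hM : IsEquationalSystem M) (a : A) (x : C.carrier.obj a) : Univ M a :=
  Univ.mk (exists_resolution hM C x).choose

variable {C}

theorem toUniv_eq_mk (hM : IsEquationalSystem M) (hC : HasSquares C.carrier) {a : A}
    {x : C.carrier.obj a} {α : Cpx M a} (h : ∀ N, x ∈ C.resolved (α.trunc N)) :
    C.toUniv hM a x = Univ.mk α :=
  mk_eq_mk hM hC fun N => ⟨x, (exists_resolution hM C x).choose_spec N, h N⟩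

/-- `toUniv` commutes with the structure maps: `ι (h x) = m ⊗ h w` if `ξ x = m ⊗ w`. -/
theorem toUniv_eq_cons (hM : IsEquationalSystem M) (hC : HasSquares C.carrier) {a b : A}
    {x : C.carrier.obj a} {m : M.Sector b a} {w : C.carrier.obj b}
    (h : C.str a x = Tensor.tmul m w) : C.toUniv hM a x = Univ.cons m (C.toUniv hM b w) := by
  refine toUniv_eq_mk hM hC (α := (exists_resolution hM C w).choose.cons m) fun N => ?_
  cases N with
  | zero => trivial
  | succ N =>
    rw [Cpx.trunc_cons]
    exact ⟨w, (exists_resolution hM C w).choose_spec N, h⟩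

theorem toUniv_map (hM : IsEquationalSystem M) (hC : HasSquares C.carrier) {a a' : A} (f : a ⟶ a')
    (x : C.carrier.obj a) : C.toUniv hM a' (C.carrier.map f x) = Univ.map f (C.toUniv hM a x) := by
  obtain ⟨b, m, w, h⟩ := (C.str a x).exists_rep
  rw [toUniv_eq_cons hM hC h.symm, toUniv_eq_cons hM hC (str_map_of_str_eq f h.symm), Univ.map_cons]

/-- Uniqueness: any coalgebra map sends `x` into every `V` cut out by a resolution of `x`. -/
theorem eq_toUniv (hM : IsEquationalSystem M) (hS : Solvable M) (hC : HasSquares C.carrier)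
    {k : ∀ a, C.carrier.obj a → Univ M a}
    (hk : ∀ {a b : A} {x : C.carrier.obj a} {m : M.Sector b a} {w : C.carrier.obj b},
      C.str a x = Tensor.tmul m w → k a x = Univ.cons m (k b w))
    {a : A} (x : C.carrier.obj a) : k a x = C.toUniv hM a x := by
  obtain ⟨α, h⟩ := exists_resolution hM C x
  rw [toUniv_eq_mk hM hC h]
  exact Univ.eq_mk_of_forall_mem_V hM hS fun N => C.mem_V_of_mem_resolved hk (h N)

end SetCoalgebra

/-- The underlying coalgebra in sets of a coalgebra in spaces. -/
def underlying (C : Endofunctor.Coalgebra (modEndo M)) : SetCoalgebra M where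
  carrier := C.V ⋙ forget TopCat.{u}
  str a := C.str.app a
  naturality f x := ConcreteCategory.congr_hom (C.str.naturality f) x

/-- For closed `W`, the set of all `m ⊗ w` with `w ∈ W` is closed in `M ⊗ X`.  Its preimage in the
copy of `X b'` indexed by `m' : b' ⇸ a` is a union, over the finitely many spans from `m'` to `m`
in the category of elements, of images under the closed maps `X g`. -/
theorem isClosed_tmul_image (hM : IsEquationalSystem M) {X : A ⥤ TopCat.{u}}
    (hX : TopNondegenerate X) {a b : A} (m : M.Sector b a) {W : Set (X.obj b)} (hW : IsClosed W) :
    IsClosed {t : Tensor (M.obj a) (X ⋙ forget TopCat.{u}) |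
      ∃ w ∈ W, t = Tensor.tmul (X := X ⋙ forget TopCat.{u}) m w} := by
  rw [isClosed_coinduced, isClosed_sigma_iff]
  rintro ⟨b', m'⟩
  have := hM.finite_obj a
  have := hM.finite_hom a
  have key : {w' : X.obj b' | ∃ w ∈ W, (Tensor.tmul (X := X ⋙ forget TopCat.{u}) m' w' :
      Tensor (M.obj a) _) = Tensor.tmul (X := X ⋙ forget TopCat.{u}) m w} =
      ⋃ s : Σ e : (M.obj a).Elements, ((M.obj a).elementsMk (op b') m' ⟶ e) ×
        ((M.obj a).elementsMk (op b) m ⟶ e),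
        (fun x : X.obj s.1.1.unop => X.map s.2.1.1.unop x) ''
          ((fun x : X.obj s.1.1.unop => X.map s.2.2.1.unop x) ⁻¹' W) := by
    ext w'
    simp only [Set.mem_ofPred_eq, Set.mem_iUnion]
    constructor
    · rintro ⟨w, hw, h⟩
      obtain ⟨c, g, g', z, rfl, rfl, h3⟩ := (tmul_eq_iff hX.1.hasSquares).1 h
      exact ⟨⟨(M.obj a).elementsMk (op c) ((M.obj a).map g.op m'), ⟨g.op, rfl⟩, ⟨g'.op, h3.symm⟩⟩,
        z, hw, rfl⟩
    · rintro ⟨⟨⟨⟨c⟩, p⟩, ⟨g, hg⟩, ⟨g', hg'⟩⟩, z, hz, rfl⟩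
      exact ⟨_, hz, (tmul_eq_iff hX.1.hasSquares).2
        ⟨c, g.unop, g'.unop, z, rfl, rfl, hg.trans hg'.symm⟩⟩
  refine (congrArg IsClosed key).mpr (isClosed_iUnion_of_finite fun s => ?_)
  exact hX.2 _ _ (hW.preimage (X.map s.2.2.1.unop).hom.continuous)

theorem isClosed_resolved (hM : IsEquationalSystem M) {C : Endofunctor.Coalgebra (modEndo M)}
    (hC : TopNondegenerate C.V) {a : A} (t : Trunc M a) :
    IsClosed (X := C.V.obj a) ((underlying C).resolved t) := by
  induction t with
  | nil => exact isClosed_univ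
  | cons m t ih =>
    exact (isClosed_tmul_image hM hC m ih).preimage (C.str.app _).hom.continuous

theorem continuous_toUniv (hM : IsEquationalSystem M) (hS : Solvable M)
    {C : Endofunctor.Coalgebra (modEndo M)} (hC : TopNondegenerate C.V) (a : A) :
    Continuous (X := C.V.obj a) ((underlying C).toUniv hM a) := by
  have hsq : HasSquares (underlying C).carrier := hC.1.hasSquares
  refine Univ.continuous_of_ultrafilter hM hS fun x F hF => ?_
  obtain ⟨α, h⟩ := SetCoalgebra.exists_cpx_forall_resolved_mem hM (underlying C) F
  refine ⟨α, SetCoalgebra.toUniv_eq_mk hM hsq fun N =>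
    isClosed_iff_ultrafilter.1 (isClosed_resolved hM hC (α.trunc N)) x F hF (h N), fun N => ?_⟩
  filter_upwards [h N] with y hy
  exact (underlying C).mem_V_of_mem_resolved (SetCoalgebra.toUniv_eq_cons hM hsq) hy

/-- The unique map from a nondegenerate coalgebra in spaces to `(I, ι)`. -/
noncomputable def toUnivCoalgebra (hM : IsEquationalSystem M) (hS : Solvable M)
    (hI : ∀ ⦃a a' : A⦄ (f : a ⟶ a'), Continuous (Univ.map f : Univ M a → Univ M a'))
    (hι : ∀ a : A, Continuous (univTopStr M hI a))
    {C : Endofunctor.Coalgebra (modEndo M)} (hC : TopNondegenerate C.V) :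
    C ⟶ univCoalgebra M hI hι where
  f :=
    { app a := TopCat.ofHom ⟨(underlying C).toUniv hM a, continuous_toUniv hM hS hC a⟩
      naturality a a' f := by
        ext x
        exact SetCoalgebra.toUniv_map (C := underlying C) hM hC.1.hasSquares f x }
  h := by
    ext a x
    obtain ⟨b, m, w, h⟩ := Tensor.exists_rep ((underlying C).str a x)
    have h1 := SetCoalgebra.toUniv_eq_cons hM (C := underlying C) hC.1.hasSquares h.symm
    exact (congrArg (Tensor.map (𝟙 (M.obj a)) _) h.symm).trans
      ((congrArg (univStr M a) h1).trans (Univ.str_cons m _)).symm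

theorem univCoalgebra_hom_unique (hM : IsEquationalSystem M) (hS : Solvable M)
    (hI : ∀ ⦃a a' : A⦄ (f : a ⟶ a'), Continuous (Univ.map f : Univ M a → Univ M a'))
    (hι : ∀ a : A, Continuous (univTopStr M hI a))
    {C : Endofunctor.Coalgebra (modEndo M)} (hC : TopNondegenerate C.V)
    (k : C ⟶ univCoalgebra M hI hι) : k = toUnivCoalgebra hM hS hI hι hC := by
  refine Endofunctor.Coalgebra.ext ?_
  ext a x
  refine SetCoalgebra.eq_toUniv (C := underlying C) hM hS hC.1.hasSquares
    (k := fun a x => k.f.app a x) (fun {a b x m w} h => ?_) x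
  refine (Univ.str_eq_tmul_iff.1 ?_).symm
  have hx := ConcreteCategory.congr_hom (NatTrans.congr_app k.h a) x
  exact hx.symm.trans (congrArg (Tensor.map (𝟙 (M.obj a))
    (Functor.whiskerRight k.f (forget TopCat.{u}))) h)

end Terminal

end SelfSim

open SelfSim in
theorem theorem7p10 {A : Type u} [SmallCategory A] (M : EndoModule A)
    (hM : IsEquationalSystem M) (hS : Solvable M) :
    (∀ a : A, CompactSpace (Univ M a) ∧ T2Space (Univ M a)) ∧
    ∃ (hI : ∀ ⦃a a' : A⦄ (f : a ⟶ a'), Continuous (Univ.map f : Univ M a → Univ M a'))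
      (hι : ∀ a : A, Continuous (univTopStr M hI a))
      (hnd : TopNondegenerate (univCoalgebra M hI hι).V),
      Nonempty (IsTerminal (C := TopCoalgebra M) ⟨univCoalgebra M hI hι, hnd⟩) := by
  have hI : ∀ ⦃a a' : A⦄ (f : a ⟶ a'), Continuous (Univ.map f : Univ M a → Univ M a') :=
    fun _ _ f => Univ.continuous_map hM hS f
  have hι : ∀ a : A, Continuous (univTopStr M hI a) := Univ.continuous_univTopStr hM hS hI
  refine ⟨fun a => ⟨Univ.compactSpace hM hS a, Univ.t2Space hM hS a⟩, hI, hι,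
    ⟨nondegenerate_univFunctor hM hS, fun a a' f => ?_⟩, ⟨?_⟩⟩
  · have := Univ.compactSpace hM hS a
    have := Univ.t2Space hM hS a'
    exact (hI f).isClosedMap
  · exact IsTerminal.ofUniqueHom (fun C => ⟨toUnivCoalgebra hM hS hI hι C.property⟩)
      fun C k => by
        refine ObjectProperty.hom_ext _ ?_
        exact univCoalgebra_hom_unique hM hS hI hι C.property k.hom
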